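/- Let $k$ be an algebraic extension of $\mathbb{Q}$ (for instance a number field, or $\overline{\mathbb{Q}}$), and let $V$ be a projective variety over $k$, i.e. an integral closed subscheme of some $\mathbb{P}^N_k$. Divisors on $V$ are Cartier divisors. A divisor $D$ is very ample if $D\sim i^*H$ for some closed embedding $i:V\to\mathbb{P}^n_k$ over $k$ and some hyperplane $H\subset\mathbb{P}^n_k$ not containing $i(V)$, and $D$ is ample if $mD$ is very ample for some integer $m>0$. A Weil height function corresponding to a divisor $D$ is a function $h_D:V(\overline{k})\to\mathbb{R}$ such that, for some $k$-morphisms $\varphi:V\to\mathbb{P}^n_k$, $\psi:V\to\mathbb{P}^m_k$ and hyperplanes $H\not\supset\varphi(V)$, $H'\not\supset\psi(V)$ with $D\sim\varphi^*H-\psi^*H'$, one has $h_D(P)=h(\varphi(P))-h(\psi(P))+O(1)$ for all $P\in V(\overline{k})$, where $h$ is the absolute logarithmic height on projective space. (1) Let $D_1,D_2$ be ample divisors on $V$ and let $h_{D_1},h_{D_2}$ be corresponding Weil height functions. Then \[ 0<\liminf_{h_{D_2}(P)\to\infty}\frac{h_{D_1}(P)}{h_{D_2}(P)},\qquad \limsup_{h_{D_2}(P)\to\infty}\frac{h_{D_1}(P)}{h_{D_2}(P)}<\infty,\qquad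 \limsup_{h_{D_2}(P)\to\infty}\left|\frac{h_{D_1}(P)}{h_{D_2}(P)}\right|<\infty . \] (2) Let $D$ be an ample divisor and $E$ an arbitrary divisor on $V$, and let $h_D,h_E$ be corresponding Weil height functions. Then \[ \limsup_{h_D(P)\to\infty}\left|\frac{h_E(P)}{h_D(P)}\right|<\infty . \] Here $P$ runs over $V(\overline{k})$, and the upper and lower limits are taken in $[-\infty,\infty]$ along the sets $\{P: h_{D_2}(P)\ge M\}$ (respectively $\{P : h_D(P)\ge M\}$), $M\to\infty$; if these sets are eventually empty, the liminf is $+\infty$ and the limsup is $-\infty$. -/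

import Mathlib

open AlgebraicGeometry CategoryTheory

universe u

noncomputable section

namespace HeightRatio

/-! ### Projective space over a field and its standard charts -/

/-- The grading of `k[X₀, …, Xₙ]` by degree. -/
abbrev grading (k : Type u) [Field k] (n : ℕ) :
    ℕ → Submodule k (MvPolynomial (Fin (n + 1)) k) :=
  MvPolynomial.homogeneousSubmodule (Fin (n + 1)) k

instance gradedAlgebra_grading (k : Type u) [Field k] (n : ℕ) : GradedAlgebra (grading k n) :=
  MvPolynomial.gradedAlgebra

/-- Projective space `ℙⁿ_k = Proj k[X₀, …, Xₙ]`. -/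
abbrev ProjSpace (k : Type u) [Field k] (n : ℕ) : Scheme.{u} :=
  Proj (grading k n)

/-- The structure morphism `ℙⁿ_k ⟶ Spec k`. -/
def ProjSpace.toSpec (k : Type u) [Field k] (n : ℕ) : ProjSpace k n ⟶ Spec (.of k) :=
  Proj.toSpecZero (grading k n) ≫
    Spec.map (CommRingCat.ofHom (algebraMap k (grading k n 0)))

/-- The standard chart `D₊(Xⱼ)`. -/
abbrev chart (k : Type u) [Field k] (n : ℕ) (j : Fin (n + 1)) : (ProjSpace k n).Opens :=
  Proj.basicOpen (grading k n) (MvPolynomial.X j)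

lemma X_mem_grading (k : Type u) [Field k] (n : ℕ) (j : Fin (n + 1)) :
    (MvPolynomial.X j : MvPolynomial (Fin (n + 1)) k) ∈ grading k n 1 :=
  (MvPolynomial.mem_homogeneousSubmodule _ _).2 (MvPolynomial.isHomogeneous_X k j)

/-- For a linear form `ℓ`, the regular function `ℓ / Xⱼ` on the chart `D₊(Xⱼ)`. -/
def ratio {k : Type u} [Field k] {n : ℕ} (ℓ : grading k n 1) (j : Fin (n + 1)) :
    Γ(ProjSpace k n, chart k n j) :=
  Proj.awayToSection (grading k n) (MvPolynomial.X j)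
    (HomogeneousLocalization.Away.mk (grading k n) (X_mem_grading k n j) 1 ℓ.1
      (by simp))

/-- The `l`-th homogeneous coordinate as a linear form. -/
def coordForm (k : Type u) [Field k] (n : ℕ) (l : Fin (n + 1)) : grading k n 1 :=
  ⟨MvPolynomial.X l, X_mem_grading k n l⟩

lemma iSup_chart (k : Type u) [Field k] (n : ℕ) : ⨆ j, chart k n j = ⊤ := by
  refine Proj.iSup_basicOpen_eq_top' (grading k n) _ (fun j => ⟨1, X_mem_grading k n j⟩) ?_
  refine top_le_iff.1 fun p _ => ?_
  induction p using MvPolynomial.induction_on with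
  | C a =>
    exact Subalgebra.algebraMap_mem _
      (⟨MvPolynomial.C a, (MvPolynomial.mem_homogeneousSubmodule _ _).2
        (MvPolynomial.isHomogeneous_C _ a)⟩ : grading k n 0)
  | add p q hp hq => exact add_mem (hp trivial) (hq trivial)
  | mul_X p i hp => exact mul_mem (hp trivial) (Algebra.subset_adjoin ⟨i, rfl⟩)

/-! ### Absolute logarithmic height -/

open Classical in
/-- The absolute logarithmic height of the point of projective space with homogeneous coordinates
`x`: if `L = ℚ(x₀, …, xₙ)` is the number field generated by the coordinates, this is
`[L : ℚ]⁻¹ ∑_w n_w log maxᵢ |xᵢ|_w`, the sum being over the places of `L`.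
(The value is `0` if the coordinates are not all algebraic over `ℚ`.) -/
def absLogHeight {ι : Type*} {K : Type*} [Field K] [CharZero K] (x : ι → K) : ℝ :=
  if hx : FiniteDimensional ℚ (IntermediateField.adjoin ℚ (Set.range x)) then
    haveI : NumberField (IntermediateField.adjoin ℚ (Set.range x)) := { to_finiteDimensional := hx }
    (Module.finrank ℚ (IntermediateField.adjoin ℚ (Set.range x)) : ℝ)⁻¹ *
      Height.logHeight (K := IntermediateField.adjoin ℚ (Set.range x))
        (fun i => ⟨x i, IntermediateField.subset_adjoin ℚ _ ⟨i, rfl⟩⟩)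
  else 0

/-! ### Points with values in a field, and their homogeneous coordinates -/

/-- The value in `L` of a section over an open set containing the image of an `L`-point. -/
def evalAt {X : Scheme.{u}} {L : Type u} [Field L] (p : Spec (.of L) ⟶ X) (U : X.Opens)
    (hU : ⊤ ≤ p ⁻¹ᵁ U) (s : Γ(X, U)) : L :=
  (Scheme.ΓSpecIso (.of L)).hom (p.appLE U ⊤ hU s)

lemma exists_chart {k L : Type u} [Field k] [Field L] {n : ℕ}
    (p : Spec (.of L) ⟶ ProjSpace k n) : ∃ j, ⊤ ≤ p ⁻¹ᵁ chart k n j := by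
  let x : Spec (.of L) := (⊥ : PrimeSpectrum L)
  have hx : p x ∈ ⨆ j, chart k n j := by rw [iSup_chart]; trivial
  obtain ⟨j, hj⟩ := TopologicalSpace.Opens.mem_iSup.1 hx
  refine ⟨j, fun y _ => ?_⟩
  have : y = x := Subsingleton.elim (α := PrimeSpectrum L) y x
  rw [this]
  exact hj

/-- Homogeneous coordinates of an `L`-point of `ℙⁿ_k`, normalized so that one of them is `1`. -/
def homCoords {k L : Type u} [Field k] [Field L] {n : ℕ}
    (p : Spec (.of L) ⟶ ProjSpace k n) : Fin (n + 1) → L := fun l =>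
  evalAt p (chart k n (exists_chart p).choose) (exists_chart p).choose_spec
    (ratio (coordForm k n l) (exists_chart p).choose)

/-- The set `V(k̄)` of geometric points of a `k`-scheme `π : V ⟶ Spec k`. -/
def GeomPoint {k : Type u} [Field k] {V : Scheme.{u}} (π : V ⟶ Spec (.of k)) : Type u :=
  {P : Spec (.of (AlgebraicClosure k)) ⟶ V //
    P ≫ π = Spec.map (CommRingCat.ofHom (algebraMap k (AlgebraicClosure k)))}

/-- The function `P ↦ h(φ(P))` on `V(k̄)`, for `φ : V ⟶ ℙⁿ` and `h` the absolute logarithmic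
height on `ℙⁿ(k̄)`. -/
def mapHeight {k : Type u} [Field k] [CharZero k] {V : Scheme.{u}} {π : V ⟶ Spec (.of k)} {n : ℕ}
    (φ : V ⟶ ProjSpace k n) (P : GeomPoint π) : ℝ :=
  haveI : CharZero (AlgebraicClosure k) := charZero_of_injective_algebraMap
    (algebraMap k (AlgebraicClosure k)).injective
  absLogHeight (homCoords (P.1 ≫ φ))

/-! ### Cartier divisors on an integral scheme -/

section Divisors

variable (V : Scheme.{u}) [IsIntegral V]

/-- The subgroup `𝒪_{V,x}ˣ` of `K(V)ˣ`. -/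
def unitsAt (x : V) : Subgroup V.functionFieldˣ :=
  (Units.map (algebraMap (V.presheaf.stalk x) V.functionField).toMonoidHom).range

/-- The group of global sections of `K(V)ˣ / 𝒪_Vˣ`, written multiplicatively: families of classes
in `K(V)ˣ / 𝒪_{V,x}ˣ` which locally come from a single rational function. -/
def cartierSubgroup : Subgroup ((x : V) → V.functionFieldˣ ⧸ unitsAt V x) where
  carrier := {D | ∀ x : V, ∃ U : V.Opens, x ∈ U ∧ ∃ f : V.functionFieldˣ,
    ∀ y ∈ U, D y = QuotientGroup.mk f}
  one_mem' _ := ⟨⊤, trivial, 1, fun _ _ => rfl⟩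
  mul_mem' {D E} hD hE x := by
    obtain ⟨U, hxU, f, hf⟩ := hD x
    obtain ⟨W, hxW, g, hg⟩ := hE x
    exact ⟨U ⊓ W, ⟨hxU, hxW⟩, f * g, fun y hy => by
      rw [Pi.mul_apply, hf y hy.1, hg y hy.2]; rfl⟩
  inv_mem' {D} hD x := by
    obtain ⟨U, hxU, f, hf⟩ := hD x
    exact ⟨U, hxU, f⁻¹, fun y hy => by rw [Pi.inv_apply, hf y hy]; rfl⟩

/-- The additive group of (Cartier) divisors on `V`. -/
abbrev Divisor : Type u := Additive (cartierSubgroup V)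

variable {V}

/-- `f` is a local equation of `D` at `x`. -/
def Divisor.IsLocalEquation (D : Divisor V) (x : V) (f : V.functionFieldˣ) : Prop :=
  D.toMul.1 x = QuotientGroup.mk f

/-- The principal divisor `div f`. -/
def Divisor.principal (f : V.functionFieldˣ) : Divisor V :=
  Additive.ofMul ⟨fun _ => QuotientGroup.mk f, fun _ => ⟨⊤, trivial, f, fun _ _ => rfl⟩⟩

/-- Linear equivalence of divisors. -/
def Divisor.LinEquiv (D E : Divisor V) : Prop :=
  ∃ f : V.functionFieldˣ, D - E = Divisor.principal f

/-- `D = φ^*H`, where `H` is the hyperplane `ℓ = 0`: wherever `φ` maps to the chart `D₊(Xⱼ)`, the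
divisor `D` has local equation `φ^*(ℓ / Xⱼ)`, which has to be a nonzero rational function
(that is, `φ(V)` is not contained in `H`). -/
def IsHyperplanePullback {k : Type u} [Field k] {n : ℕ} (φ : V ⟶ ProjSpace k n)
    (ℓ : grading k n 1) (D : Divisor V) : Prop :=
  ∀ (j : Fin (n + 1)) (x : V) (hx : x ∈ φ ⁻¹ᵁ chart k n j),
    ∃ f : V.functionFieldˣ,
      (f : V.functionField) = algebraMap (V.presheaf.stalk x) V.functionField
        (V.presheaf.germ (φ ⁻¹ᵁ chart k n j) x hx (φ.app (chart k n j) (ratio ℓ j))) ∧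
      D.IsLocalEquation x f

/-- `D` is linearly equivalent to `φ^*H` for a hyperplane `H`. -/
def IsHyperplaneClass {k : Type u} [Field k] {n : ℕ} (φ : V ⟶ ProjSpace k n)
    (D : Divisor V) : Prop :=
  ∃ (ℓ : grading k n 1) (A : Divisor V), IsHyperplanePullback φ ℓ A ∧ D.LinEquiv A

end Divisors

/-! ### Projectivity, ampleness and Weil heights -/

section Heights

variable {k : Type u} [Field k] {V : Scheme.{u}}

/-- `V` is projective over `k`: it is a closed subscheme of some `ℙⁿ_k`. -/
def IsProjective (π : V ⟶ Spec (.of k)) : Prop :=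
  ∃ (n : ℕ) (φ : V ⟶ ProjSpace k n), φ ≫ ProjSpace.toSpec k n = π ∧ IsClosedImmersion φ

variable [IsIntegral V]

/-- `D` is very ample: it is a hyperplane section, up to linear equivalence, for some closed
embedding of `V` in a projective space. -/
def IsVeryAmple (π : V ⟶ Spec (.of k)) (D : Divisor V) : Prop :=
  ∃ (n : ℕ) (φ : V ⟶ ProjSpace k n), φ ≫ ProjSpace.toSpec k n = π ∧ IsClosedImmersion φ ∧
    IsHyperplaneClass φ D

/-- `D` is ample: some positive multiple is very ample. -/
def IsAmple (π : V ⟶ Spec (.of k)) (D : Divisor V) : Prop :=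
  ∃ m : ℕ, 0 < m ∧ IsVeryAmple π (m • D)

/-- `h` is a Weil height function on `V(k̄)` corresponding to `D`: writing `D ∼ A - B` with
`A`, `B` the hyperplane classes of morphisms `φ : V ⟶ ℙⁿ`, `ψ : V ⟶ ℙᵐ` over `k`, one has
`h = h ∘ φ - h ∘ ψ + O(1)`. -/
def IsWeilHeight [CharZero k] (π : V ⟶ Spec (.of k)) (D : Divisor V)
    (h : GeomPoint π → ℝ) : Prop :=
  ∃ (n m : ℕ) (φ : V ⟶ ProjSpace k n) (ψ : V ⟶ ProjSpace k m) (A B : Divisor V),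
    φ ≫ ProjSpace.toSpec k n = π ∧ ψ ≫ ProjSpace.toSpec k m = π ∧
    IsHyperplaneClass φ A ∧ IsHyperplaneClass ψ B ∧ D.LinEquiv (A - B) ∧
    ∃ C : ℝ, ∀ P : GeomPoint π, |h P - (mapHeight φ P - mapHeight ψ P)| ≤ C

end Heights

end HeightRatio

end

open HeightRatio Filter

noncomputable section

namespace HeightRatio

/-! ### Heights under extension of number fields -/

section Extension

open NumberField Height Module

/-! Everything follows from one domination statement, `exists_abs_le_of_isAmple`: if `D` is ample,
then `|h_E| ≤ a h_D + b` with `a, b ≥ 0`. Applied to `D₂` and `D₁` it bounds the limsups; with the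
roles exchanged it bounds the liminf below. It is obtained by passing through the height of a closed
embedding `i`, with two inequalities.

Upper bound (`exists_mapHeight_le`): `h ∘ φ ≤ N (h ∘ i) + C` for every morphism `φ`. Locally on `V`,
the coordinates of `φ` are, up to a common factor, forms of one degree in the coordinates of `i`;
quasi-compactness makes the constants uniform. Since heights are nonnegative, any difference `h ∘ φ
- h ∘ ψ` is then bounded in absolute value.

Lower bound (`exists_mul_mapHeight_add_le`): write `D ∼ φ^*H - ψ^*H'` and `mD ∼ i^*H''`. Then `m
φ^*H ∼ m ψ^*H' + i^*H''`, so with homogeneous coordinates `x, y, z` of the three morphisms the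
quotients `y_l^m z_q / x_j^m`, up to one rational function, are regular on the intersections of
charts. These are affine, with rings generated by ratios of Segre products, so each quotient is a
form in the Segre coordinates over a power of one of them. Comparing heights in this identity
(`mul_absLogHeight_add_le_of_forms`) gives `m h(y) + h(z) ≤ m h(x) + O(1)`, that is `h ∘ i ≤ m h_D +
O(1)`. No additivity or uniqueness theorem for Weil heights is needed.

Both inequalities rest on elementary properties of the absolute height, which reduce to a single
number field because the normalized height is invariant under extension. -/

lemma prod_infinitePlace_iSup_eq_prod_embeddings {K ι : Type*} [Field K] [NumberField K]
    (x : ι → K) :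
    ∏ v : InfinitePlace K, (⨆ i, v (x i)) ^ v.mult = ∏ σ : K →+* ℂ, ⨆ i, ‖σ (x i)‖ := by
  classical
  rw [← Finset.prod_fiberwise Finset.univ InfinitePlace.mk (fun σ : K →+* ℂ => ⨆ i, ‖σ (x i)‖)]
  refine Finset.prod_congr rfl fun w _ => ?_
  have (σ) (hσ : σ ∈ ({σ | InfinitePlace.mk σ = w} : Finset (K →+* ℂ))) :
      ⨆ i, ‖σ (x i)‖ = ⨆ i, w (x i) := by
    simp_rw [← (Finset.mem_filter.mp hσ).2, InfinitePlace.apply]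
  rw [Finset.prod_congr rfl this, Finset.prod_const, InfinitePlace.card_filter_mk_eq]

variable {K L : Type*} [Field K] [NumberField K] [Field L] [NumberField L] [Algebra K L]

/-- With `ℂ` viewed as a `K`-algebra through `σ`, the extensions of `σ` are exactly the `K`-algebra
maps `L → ℂ`. -/
lemma card_embeddings_extending (σ : K →+* ℂ) [DecidableEq (K →+* ℂ)] :
    (Finset.univ.filter fun τ : L →+* ℂ => τ.comp (algebraMap K L) = σ).card = finrank K L := by
  let := σ.toAlgebra
  have : FiniteDimensional K L := FiniteDimensional.right ℚ K L
  rw [← AlgHom.card K L ℂ, ← Fintype.card_subtype]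
  refine Fintype.card_congr
    { toFun := fun τ => { τ.1 with commutes' := fun r => RingHom.congr_fun τ.2 r }
      invFun := fun τ => ⟨τ, RingHom.ext fun r => τ.commutes r⟩
      left_inv := fun τ => rfl
      right_inv := fun τ => rfl }

lemma prod_embeddings_algebraMap {ι : Type*} (x : ι → K) :
    ∏ τ : L →+* ℂ, ⨆ i, ‖τ (algebraMap K L (x i))‖ =
      (∏ σ : K →+* ℂ, ⨆ i, ‖σ (x i)‖) ^ finrank K L := by
  classical
  rw [← Finset.prod_fiberwise Finset.univ (fun τ : L →+* ℂ => τ.comp (algebraMap K L)),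
    ← Finset.prod_pow]
  refine Finset.prod_congr rfl fun σ _ => ?_
  have (τ) (hτ : τ ∈ ({τ | τ.comp (algebraMap K L) = σ} : Finset (L →+* ℂ))) :
      ⨆ i, ‖τ (algebraMap K L (x i))‖ = ⨆ i, ‖σ (x i)‖ := by
    simp_rw [← (Finset.mem_filter.mp hτ).2, RingHom.comp_apply]
  rw [Finset.prod_congr rfl this, Finset.prod_const]
  congr 1
  convert card_embeddings_extending (L := L) σ

/-- The finite part of the height of an integral tuple is the inverse of the absolute norm of the
ideal it spans, and extending an ideal to `𝓞 L` raises its absolute norm to the power `[L : K]`. -/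
lemma finprod_finitePlace_algebraMap {ι : Type*} [Finite ι] {x : ι → 𝓞 K} (hx : x ≠ 0) :
    ∏ᶠ v : FinitePlace L, ⨆ i, v (algebraMap K L (x i)) =
      (∏ᶠ v : FinitePlace K, ⨆ i, v (x i)) ^ finrank K L := by
  have hinj : Function.Injective (algebraMap (𝓞 K) (𝓞 L)) := FaithfulSMul.algebraMap_injective _ _
  have hx' : (fun i => algebraMap (𝓞 K) (𝓞 L) (x i)) ≠ 0 := by
    obtain ⟨i, hi⟩ := Function.ne_iff.1 hx
    exact Function.ne_iff.2 ⟨i, by simpa using hi⟩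
  have hK := absNorm_mul_finprod_finitePlace_eq_one hx
  have hL := absNorm_mul_finprod_finitePlace_eq_one hx'
  have hspan : Ideal.span (Set.range fun i => algebraMap (𝓞 K) (𝓞 L) (x i)) =
      Ideal.map (algebraMap (𝓞 K) (𝓞 L)) (Ideal.span (Set.range x)) := by
    rw [Ideal.map_span, ← Set.range_comp]; rfl
  rw [hspan, Ideal.absNorm_algebraMap, ← IsFractionRing.finrank_eq (𝓞 K) K (𝓞 L) L] at hL
  have hcoe (i : ι) : ((algebraMap (𝓞 K) (𝓞 L) (x i) : 𝓞 L) : L) = algebraMap K L (x i) := rfl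
  simp only [hcoe] at hL
  have h0 : ((Ideal.absNorm (Ideal.span (Set.range x)) : ℕ) : ℝ) ^ finrank K L ≠ 0 :=
    pow_ne_zero _ (left_ne_zero_of_mul (hK.trans_ne one_ne_zero))
  refine mul_left_cancel₀ h0 ?_
  rw [← mul_pow, hK, one_pow]
  exact_mod_cast hL

/-- By invariance under scaling the tuple may be taken integral; the finite and infinite parts are
then compared separately. -/
lemma mulHeight_algebraMap {ι : Type*} [Finite ι] (x : ι → K) :
    mulHeight (fun i => algebraMap K L (x i)) = mulHeight x ^ finrank K L := by
  rcases eq_or_ne x 0 with rfl | hx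
  · have : (fun i => algebraMap K L ((0 : ι → K) i)) = 0 := by ext; simp
    rw [this, mulHeight_zero, mulHeight_zero, one_pow]
  obtain ⟨b, hb⟩ := IsLocalization.exist_integer_multiples_of_finite (nonZeroDivisors (𝓞 K)) x
  choose y hy using hb
  have hb0 : algebraMap (𝓞 K) K b ≠ 0 := by
    simp
  have hyx : (fun i => (y i : K)) = algebraMap (𝓞 K) K b • x := by
    ext i; rw [Pi.smul_apply, smul_eq_mul, ← Algebra.smul_def]; exact hy i
  have hyx' : (fun i => algebraMap K L (y i)) =
      algebraMap K L (algebraMap (𝓞 K) K b) • fun i => algebraMap K L (x i) := by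
    ext i
    rw [congrFun hyx i]; simp
  have hy1 : (fun i => (y i : K)) ≠ 0 := by
    rw [hyx]; exact smul_ne_zero hb0 hx
  have hy0 : y ≠ 0 := by rintro rfl; exact hy1 (by ext; simp)
  have hy2 : (fun i => algebraMap K L (y i)) ≠ 0 := by
    obtain ⟨i, hi⟩ := Function.ne_iff.1 hy1
    exact Function.ne_iff.2 ⟨i, by simpa using hi⟩
  rw [← mulHeight_smul_eq_mulHeight x hb0, ← hyx,
    ← mulHeight_smul_eq_mulHeight _ ((map_ne_zero (algebraMap K L)).2 hb0), ← hyx',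
    NumberField.mulHeight_eq hy1, NumberField.mulHeight_eq hy2, finprod_finitePlace_algebraMap hy0,
    prod_infinitePlace_iSup_eq_prod_embeddings, prod_infinitePlace_iSup_eq_prod_embeddings,
    prod_embeddings_algebraMap, mul_pow]

lemma logHeight_algebraMap {ι : Type*} [Finite ι] (x : ι → K) :
    logHeight (fun i => algebraMap K L (x i)) = finrank K L * logHeight x := by
  rw [logHeight_eq_log_mulHeight, logHeight_eq_log_mulHeight, mulHeight_algebraMap, Real.log_pow]

end Extension

/-! ### The absolute height -/

section AbsoluteHeight

open Height Module

variable {F : Type*} [Field F] [CharZero F] {ι ι' : Type*}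

/-- The height can be computed in any number field containing the coordinates. The later properties
are proved by choosing one `L` containing all the data. -/
lemma absLogHeight_coe [Finite ι] (L : IntermediateField ℚ F) [NumberField L] (x : ι → L) :
    absLogHeight (fun i => (x i : F)) = (finrank ℚ L : ℝ)⁻¹ * logHeight x := by
  let E := IntermediateField.adjoin ℚ (Set.range fun i => (x i : F))
  have hE : E ≤ L := IntermediateField.adjoin_le_iff.2 (by rintro _ ⟨i, rfl⟩; exact (x i).2)
  let : Algebra E L := (IntermediateField.inclusion hE).toAlgebra
  have : IsScalarTower ℚ E L := .of_algebraMap_eq fun _ => rfl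
  have hfin : FiniteDimensional ℚ E :=
    FiniteDimensional.of_injective (IntermediateField.inclusion hE).toLinearMap
      (IntermediateField.inclusion hE).injective
  have : NumberField E := { to_finiteDimensional := hfin }
  have : FiniteDimensional E L := FiniteDimensional.right ℚ E L
  rw [absLogHeight, dif_pos hfin]
  have h := logHeight_algebraMap (K := E) (L := L)
    (fun i => ⟨x i, IntermediateField.subset_adjoin ℚ _ ⟨i, rfl⟩⟩)
  have hx : (fun i => algebraMap E L ⟨x i, IntermediateField.subset_adjoin ℚ _ ⟨i, rfl⟩⟩) = x := rfl
  rw [hx] at h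
  rw [h, ← finrank_mul_finrank ℚ E L]
  have : (finrank E L : ℝ) ≠ 0 := by exact_mod_cast finrank_pos.ne'
  push_cast
  field_simp
  rfl

variable [Algebra.IsAlgebraic ℚ F]

lemma exists_numberField_forall_mem {κ : Type*} [Finite κ] (x : κ → F) :
    ∃ L : IntermediateField ℚ F, NumberField L ∧ ∀ i, x i ∈ L := by
  refine ⟨IntermediateField.adjoin ℚ (Set.range x), { to_finiteDimensional := ?_ }, fun i =>
    IntermediateField.subset_adjoin ℚ _ ⟨i, rfl⟩⟩
  exact IntermediateField.finiteDimensional_adjoin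
    fun y _ => (Algebra.IsAlgebraic.isAlgebraic y).isIntegral

lemma absLogHeight_nonneg [Finite ι] (x : ι → F) : 0 ≤ absLogHeight x := by
  obtain ⟨L, _, hx⟩ := exists_numberField_forall_mem x
  lift x to ι → L using hx
  rw [absLogHeight_coe L x]
  exact mul_nonneg (by positivity) (logHeight_nonneg _)

lemma absLogHeight_smul [Finite ι] (x : ι → F) {c : F} (hc : c ≠ 0) :
    absLogHeight (c • x) = absLogHeight x := by
  obtain ⟨L, _, hL⟩ := exists_numberField_forall_mem (Option.elim · c x)
  have hx := fun i => hL (some i)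
  lift x to ι → L using hx
  lift c to L using hL none
  rw [absLogHeight_coe L x, ← logHeight_smul_eq_logHeight x (c := c) (by simpa using hc),
    ← absLogHeight_coe]
  rfl

lemma absLogHeight_fun_mul [Finite ι] [Finite ι'] {x : ι → F} (hx : x ≠ 0) {y : ι' → F}
    (hy : y ≠ 0) :
    absLogHeight (fun p : ι × ι' => x p.1 * y p.2) = absLogHeight x + absLogHeight y := by
  obtain ⟨L, _, hL⟩ := exists_numberField_forall_mem (Sum.elim x y)
  have hxL := fun i => hL (.inl i)
  have hyL := fun i => hL (.inr i)
  lift x to ι → L using hxL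
  lift y to ι' → L using hyL
  have hx' : x ≠ 0 := by rintro rfl; exact hx rfl
  have hy' : y ≠ 0 := by rintro rfl; exact hy rfl
  rw [absLogHeight_coe L x, absLogHeight_coe L y, ← mul_add, ← logHeight_fun_mul_eq hx' hy',
    ← absLogHeight_coe]
  rfl

lemma absLogHeight_pow [Finite ι] (x : ι → F) (n : ℕ) :
    absLogHeight (x ^ n) = n * absLogHeight x := by
  obtain ⟨L, _, hL⟩ := exists_numberField_forall_mem x
  lift x to ι → L using hL
  rw [absLogHeight_coe L x, mul_left_comm, ← logHeight_pow, ← absLogHeight_coe]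
  rfl

lemma absLogHeight_mul_le [Finite ι] (x y : ι → F) :
    absLogHeight (x * y) ≤ absLogHeight x + absLogHeight y := by
  obtain ⟨L, _, hL⟩ := exists_numberField_forall_mem (Sum.elim x y)
  have hxL := fun i => hL (.inl i)
  have hyL := fun i => hL (.inr i)
  lift x to ι → L using hxL
  lift y to ι → L using hyL
  rw [absLogHeight_coe L x, absLogHeight_coe L y, ← mul_add]
  refine le_trans (le_of_eq ?_) (mul_le_mul_of_nonneg_left (logHeight_mul_le x y) (by positivity))
  rw [← absLogHeight_coe]
  rfl

/-- Products over all `n`-tuples of coordinates: the `n`-th tensor power of `x`. -/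
def tensorPow {R : Type*} [CommMonoid R] (x : ι → R) (n : ℕ) : (Fin n → ι) → R :=
  fun s => ∏ i, x (s i)

lemma absLogHeight_tensorPow [Finite ι] {x : ι → F} (hx : x ≠ 0) (n : ℕ) :
    absLogHeight (tensorPow x n) = n * absLogHeight x := by
  obtain ⟨L, _, hL⟩ := exists_numberField_forall_mem x
  lift x to ι → L using hL
  have hx' : x ≠ 0 := by rintro rfl; exact hx rfl
  have h := logHeight_fun_prod_eq (α := Fin n) (x := fun _ => x) (fun _ => hx')
  rw [Finset.sum_const, Finset.card_fin, nsmul_eq_mul] at h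
  rw [absLogHeight_coe L x, mul_left_comm, ← h, ← absLogHeight_coe]
  congr 1
  ext s
  simp [tensorPow]

lemma absLogHeight_linearMap_le [Fintype ι] [Finite ι'] (A : ι' × ι → F) (x : ι → F) :
    absLogHeight (fun j => ∑ i, A (j, i) * x i) ≤
      Real.log (Nat.card ι) + absLogHeight A + absLogHeight x := by
  obtain ⟨L, _, hL⟩ := exists_numberField_forall_mem (Sum.elim A x)
  have hxL := fun i => hL (.inl i)
  have hyL := fun i => hL (.inr i)
  lift A to ι' × ι → L using hxL
  lift x to ι → L using hyL
  have h := mul_le_mul_of_nonneg_left (logHeight_linearMap_apply_le A x)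
    (show 0 ≤ (finrank ℚ L : ℝ)⁻¹ by positivity)
  have h0 : (finrank ℚ L : ℝ) ≠ 0 := by exact_mod_cast finrank_pos.ne'
  -- The archimedean contribution is `[L : ℚ] log |ι|`; after normalization it no longer depends on
  -- `L`, so the constant is uniform in `x`.
  rw [NumberField.totalWeight_eq_finrank, mul_add, mul_add, inv_mul_cancel_left₀ h0,
    ← absLogHeight_coe, ← absLogHeight_coe, ← absLogHeight_coe] at h
  refine le_trans (le_of_eq ?_) h
  congr 1
  ext j
  simp

end AbsoluteHeight

end HeightRatio

end

noncomputable section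

namespace HeightRatio

/-! ### Height inequalities from polynomial relations -/

section HeightInequalities

variable {F : Type*} [Field F] {ι ι' κ μ : Type*}

/-- The Segre product of three tuples. -/
def segre {R : Type*} [CommMonoid R] (x : ι → R) (y : κ → R) (z : μ → R) : ι × κ × μ → R :=
  fun τ => x τ.1 * (y τ.2.1 * z τ.2.2)

lemma segre_ne_zero {x : ι → F} {y : κ → F} {z : μ → F} (hx : x ≠ 0) (hy : y ≠ 0) (hz : z ≠ 0) :
    segre x y z ≠ 0 := by
  obtain ⟨i, hi⟩ := Function.ne_iff.1 hx
  obtain ⟨j, hj⟩ := Function.ne_iff.1 hy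
  obtain ⟨l, hl⟩ := Function.ne_iff.1 hz
  exact Function.ne_iff.2 ⟨(i, j, l), mul_ne_zero hi (mul_ne_zero hj hl)⟩

lemma pow_tuple_ne_zero {x : ι → F} (hx : x ≠ 0) (n : ℕ) : x ^ n ≠ 0 := by
  obtain ⟨i, hi⟩ := Function.ne_iff.1 hx
  exact Function.ne_iff.2 ⟨i, pow_ne_zero n hi⟩

variable [CharZero F] [Algebra.IsAlgebraic ℚ F]

/-- A form of degree `N` in `z` is a linear form in the `N`-th tensor power of `z`, whose height is
`N h(z)`; the factor `c` does not affect the height. -/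
lemma absLogHeight_le_of_forms [Fintype ι] [Finite ι'] {N : ℕ} (A : ι' × (Fin N → ι) → F) :
    ∃ C : ℝ, ∀ (z : ι → F) (x : ι' → F) (c : F), z ≠ 0 → c ≠ 0 →
      (∀ j, c * x j = ∑ s, A (j, s) * tensorPow z N s) →
        absLogHeight x ≤ N * absLogHeight z + C := by
  classical
  refine ⟨Real.log (Nat.card (Fin N → ι)) + absLogHeight A, fun z x c hz hc h => ?_⟩
  have h1 := absLogHeight_linearMap_le A (tensorPow z N)
  rw [← funext h, absLogHeight_tensorPow hz] at h1
  have h2 := absLogHeight_smul x hc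
  rw [← h2]
  exact h1.trans_eq (by ring)

lemma absLogHeight_segre [Finite ι] [Finite κ] [Finite μ] {x : ι → F} {y : κ → F} {z : μ → F}
    (hx : x ≠ 0) (hy : y ≠ 0) (hz : z ≠ 0) :
    absLogHeight (segre x y z) = absLogHeight x + (absLogHeight y + absLogHeight z) := by
  rw [← absLogHeight_fun_mul hy hz, ← absLogHeight_fun_mul hx]
  · rfl
  · obtain ⟨i, hi⟩ := Function.ne_iff.1 hy
    obtain ⟨j, hj⟩ := Function.ne_iff.1 hz
    exact Function.ne_iff.2 ⟨(i, j), mul_ne_zero hi hj⟩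

/-- If `a y_l^m z_q / x_j^m` is, wherever it is defined, a polynomial in the ratios
`x_i / x_j`, `y_i / y_l`, `z_i / z_q`, then `m h(y) + h(z) ≤ m h(x) + O(1)`. -/
lemma mul_absLogHeight_add_le_of_forms [Fintype ι] [Fintype κ] [Fintype μ] (m M : ℕ)
    (A : (ι × κ × μ) × (Fin M → ι × κ × μ) → F) :
    ∃ C : ℝ, ∀ (x : ι → F) (y : κ → F) (z : μ → F) (a : F), x ≠ 0 → y ≠ 0 → z ≠ 0 → a ≠ 0 →
      (∀ τ : ι × κ × μ, segre x y z τ ≠ 0 →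
        a * (y τ.2.1 ^ m * z τ.2.2) * segre x y z τ ^ M =
          x τ.1 ^ m * ∑ s, A (τ, s) * tensorPow (segre x y z) M s) →
      m * absLogHeight y + absLogHeight z ≤ m * absLogHeight x + C := by
  classical
  refine ⟨Real.log (Nat.card (Fin M → ι × κ × μ)) + absLogHeight A,
    fun x y z a hx hy hz ha h => ?_⟩
  have ht := segre_ne_zero hx hy hz
  -- The hypothesis is multiplied once more by the Segre coordinate `t_τ`, so that it also holds, as
  -- `0 = 0`, where `t_τ = 0`. Both sides are then tuples over all `τ`, and the left one is a Segre
  -- product of powers.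
  have key : a • segre (x ^ (M + 1)) (y ^ (m + (M + 1))) (z ^ (M + 2)) =
      segre (x ^ (m + 1)) y z * fun τ => ∑ s, A (τ, s) * tensorPow (segre x y z) M s := by
    ext τ
    simp only [Pi.smul_apply, Pi.mul_apply, smul_eq_mul]
    by_cases hτ : segre x y z τ = 0
    · have h1 : segre (x ^ (m + 1)) y z τ = x τ.1 ^ m * segre x y z τ := by
        simp only [segre, Pi.pow_apply]; ring
      have h2 : segre (x ^ (M + 1)) (y ^ (m + (M + 1))) (z ^ (M + 2)) τ =
          y τ.2.1 ^ m * z τ.2.2 * segre x y z τ ^ M * segre x y z τ := by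
        simp only [segre, Pi.pow_apply]; ring
      rw [h1, h2, hτ]; ring
    · have h1 := congrArg (· * segre x y z τ) (h τ hτ)
      calc _ = a * (y τ.2.1 ^ m * z τ.2.2) * segre x y z τ ^ M * segre x y z τ := by
            simp only [segre, Pi.pow_apply]; ring
        _ = _ := by
            rw [h1]; simp only [segre, Pi.pow_apply]; ring
  have h1 := absLogHeight_mul_le (segre (x ^ (m + 1)) y z)
    (fun τ => ∑ s, A (τ, s) * tensorPow (segre x y z) M s)
  have h2 := absLogHeight_linearMap_le A (tensorPow (segre x y z) M)
  rw [← key, absLogHeight_smul _ ha, absLogHeight_segre (pow_tuple_ne_zero hx _)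
    (pow_tuple_ne_zero hy _) (pow_tuple_ne_zero hz _), absLogHeight_segre (pow_tuple_ne_zero hx _)
    hy hz] at h1
  rw [absLogHeight_tensorPow ht, absLogHeight_segre hx hy hz] at h2
  simp only [absLogHeight_pow] at h1
  push_cast at h1
  -- The terms `M (h(x) + h(y) + h(z))` and `h(x) + h(y) + h(z)` cancel from both sides.
  nlinarith [h1, h2]

end HeightInequalities

/-! ### Algebras generated by a tuple with a coordinate equal to one -/

section Generation

variable {k R : Type*} [CommRing k] [CommRing R] {ι : Type*}

/-- `R` is generated, as an algebra over `k` via `c`, by `S`. -/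
def GeneratedBy (c : k →+* R) (S : Set R) : Prop :=
  Subring.closure (Set.range c ∪ S) = ⊤

lemma GeneratedBy.eq_top {c : k →+* R} {S : Set R} (h : GeneratedBy c S) (T : Subring R)
    (hc : ∀ a, c a ∈ T) (hS : S ⊆ T) : T = ⊤ :=
  top_le_iff.1 (h ▸ (Subring.closure_le.2 (Set.union_subset (by rintro _ ⟨a, rfl⟩; exact hc a) hS)))

lemma generatedBy_of_forall {c : k →+* R} {S : Set R}
    (h : ∀ T : Subring R, (∀ a, c a ∈ T) → S ⊆ T → T = ⊤) : GeneratedBy c S :=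
  h _ (fun a => Subring.subset_closure (.inl ⟨a, rfl⟩))
    (fun _ hs => Subring.subset_closure (.inr hs))

lemma span_range_pow_eq [Algebra k R] (w : ι → R) (M : ℕ) :
    Submodule.span k (Set.range w) ^ M = Submodule.span k (Set.range (tensorPow w M)) := by
  induction M with
  | zero =>
    rw [pow_zero, Submodule.one_eq_span]
    congr 1
    ext r
    simp [tensorPow, eq_comm]
  | succ M ih =>
    rw [pow_succ, ih, Submodule.span_mul_span]
    congr 1
    ext r
    simp only [Set.mem_mul, Set.mem_range, exists_exists_eq_and, tensorPow]
    constructor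
    · rintro ⟨s, i, rfl⟩
      exact ⟨Fin.snoc s i, by simp [Fin.prod_univ_castSucc]⟩
    · rintro ⟨s, rfl⟩
      exact ⟨fun i => s i.castSucc, s (Fin.last M), by simp [Fin.prod_univ_castSucc]⟩

/-- Since `w q = 1`, every polynomial in `w` can be homogenized to any large enough degree: the
powers of the span of `w` increase and their union is a subring containing the generators. Allowing
every `M ≥ N` lets finitely many elements share one degree. -/
lemma GeneratedBy.exists_forms [Fintype ι] {c : k →+* R} {w : ι → R}
    (h : GeneratedBy c (Set.range w)) {q : ι} (hq : w q = 1) (r : R) :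
    ∃ N : ℕ, ∀ M ≥ N, ∃ A : (Fin M → ι) → k, r = ∑ s, c (A s) * tensorPow w M s := by
  classical
  let := c.toAlgebra
  set S := Submodule.span k (Set.range w) with hS
  have h1 : (1 : Submodule k R) ≤ S := by
    rw [Submodule.one_le, ← hq]; exact Submodule.subset_span ⟨q, rfl⟩
  have hmono : Monotone fun n : ℕ => S ^ n := fun a b hab => pow_le_pow_right' h1 hab
  let T : Subring R :=
    { carrier := {r | ∃ N, r ∈ S ^ N}
      mul_mem' := by
        rintro a b ⟨N, ha⟩ ⟨M, hb⟩
        exact ⟨N + M, pow_add S N M ▸ Submodule.mul_mem_mul ha hb⟩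
      one_mem' := ⟨0, by rw [pow_zero]; exact Submodule.one_le.1 le_rfl⟩
      add_mem' := by
        rintro a b ⟨N, ha⟩ ⟨M, hb⟩
        exact ⟨max N M, add_mem (hmono (le_max_left N M) ha) (hmono (le_max_right N M) hb)⟩
      zero_mem' := ⟨0, zero_mem _⟩
      neg_mem' := by rintro a ⟨N, ha⟩; exact ⟨N, neg_mem ha⟩ }
  have hT : T = ⊤ := by
    refine h.eq_top T (fun a => ⟨0, ?_⟩) ?_
    · rw [pow_zero]; exact Submodule.algebraMap_mem a
    · rintro _ ⟨i, rfl⟩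
      exact ⟨1, by rw [pow_one]; exact Submodule.subset_span ⟨i, rfl⟩⟩
  obtain ⟨N, hN⟩ : r ∈ T := hT ▸ Subring.mem_top r
  refine ⟨N, fun M hM => ?_⟩
  have hr : r ∈ S ^ M := hmono hM hN
  rw [hS, span_range_pow_eq, Submodule.mem_span_range_iff_exists_fun] at hr
  obtain ⟨A, hA⟩ := hr
  exact ⟨A, hA.symm⟩

end Generation

end HeightRatio

end

noncomputable section

namespace HeightRatio

/-! ### Sections over intersections of affine opens -/

open Limits

/-- Both legs factor through `T`, so the universal property gives a map `D → T` whose composite with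
the inclusion is the identity. -/
lemma subring_eq_top_of_isPushout {A B C D : CommRingCat.{u}} {f : A ⟶ B} {g : A ⟶ C} {b : B ⟶ D}
    {c : C ⟶ D} (h : IsPushout f g b c) (T : Subring D) (hb : ∀ x, b x ∈ T) (hc : ∀ x, c x ∈ T) :
    T = ⊤ := by
  let b' : B ⟶ CommRingCat.of T := CommRingCat.ofHom (b.hom.codRestrict T hb)
  let c' : C ⟶ CommRingCat.of T := CommRingCat.ofHom (c.hom.codRestrict T hc)
  let ι : CommRingCat.of T ⟶ D := CommRingCat.ofHom T.subtype
  have hb' : b' ≫ ι = b := rfl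
  have hc' : c' ≫ ι = c := rfl
  have w : f ≫ b' = g ≫ c' := by
    ext x
    have hx : (f ≫ b) x = (g ≫ c) x := by rw [h.w]
    exact hx
  have hid : h.desc b' c' w ≫ ι = 𝟙 D := by
    refine h.hom_ext ?_ ?_
    · rw [h.inl_desc_assoc, hb', Category.comp_id]
    · rw [h.inr_desc_assoc, hc', Category.comp_id]
  refine top_le_iff.1 fun x _ => ?_
  have hx := congrArg (fun φ : D ⟶ D => φ x) hid
  have : ((h.desc b' c' w x : T) : D) = x := hx
  rw [← this]
  exact Subtype.property _

/-- For a morphism `f : X ⟶ Y` to a scheme separated over an affine scheme and affine opens `U`, `W`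
of `X`, `Y`, the open set `U ∩ f⁻¹ W` is affine, and its sections are generated by those of `U` and
those of `W`. -/
lemma isAffineOpen_inf_preimage {X Y S : Scheme.{u}} (f : X ⟶ Y) (g : Y ⟶ S) [IsAffine S]
    [IsSeparated g] {U : X.Opens} (hU : IsAffineOpen U) {W : Y.Opens} (hW : IsAffineOpen W) :
    IsAffineOpen (U ⊓ f ⁻¹ᵁ W) ∧ ∀ T : Subring Γ(X, U ⊓ f ⁻¹ᵁ W),
      (∀ s : Γ(X, U), X.presheaf.map (homOfLE inf_le_left).op s ∈ T) →
      (∀ s : Γ(Y, W), f.appLE W (U ⊓ f ⁻¹ᵁ W) inf_le_right s ∈ T) → T = ⊤ := by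
  have : IsAffine U := hU
  have : IsAffine W := hW
  have hp : IsPullback (X.homOfLE (inf_le_left : U ⊓ f ⁻¹ᵁ W ≤ U))
      (f.resLE W (U ⊓ f ⁻¹ᵁ W) inf_le_right) (U.ι ≫ f) W.ι := by
    have h := (isPullback_opens_inf U (f ⁻¹ᵁ W)).flip.paste_horiz (isPullback_morphismRestrict f W)
    rw [← Scheme.Hom.resLE_eq_morphismRestrict, Scheme.Hom.map_resLE] at h
    exact h.flip
  have hc := IsPullback.of_hasPullback ((U.ι ≫ f) ≫ g) (W.ι ≫ g)
  -- This is the map `U ∩ f⁻¹ W = U ×_Y W → U ×_S W`, a base change of the diagonal of `g`, hence a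
  -- closed immersion into an affine scheme. Its map on global sections is surjective, and those of
  -- `U ×_S W` come from `U` and `W`.
  let δ := hp.isoPullback.hom ≫ pullback.mapDesc (U.ι ≫ f) W.ι g
  have hδ : IsClosedImmersion δ := inferInstance
  have hδ1 : δ ≫ pullback.fst _ _ = X.homOfLE inf_le_left := by
    have h : pullback.mapDesc (U.ι ≫ f) W.ι g ≫ pullback.fst _ _ = pullback.fst _ _ :=
      (pullback.lift_fst _ _ _).trans (Category.comp_id _)
    rw [Category.assoc, h, hp.isoPullback_hom_fst]
  have hδ2 : δ ≫ pullback.snd _ _ = f.resLE W (U ⊓ f ⁻¹ᵁ W) inf_le_right := by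
    have h : pullback.mapDesc (U.ι ≫ f) W.ι g ≫ pullback.snd _ _ = pullback.snd _ _ :=
      (pullback.lift_snd _ _ _).trans (Category.comp_id _)
    rw [Category.assoc, h, hp.isoPullback_hom_snd]
  obtain ⟨haff, hsurj⟩ := IsClosedImmersion.isAffine_surjective_of_isAffine δ
  refine ⟨haff, fun T hTU hTW => ?_⟩
  let e := (U ⊓ f ⁻¹ᵁ W).topIso
  have hT' : (T.comap e.hom.hom).comap δ.appTop.hom = ⊤ := by
    refine subring_eq_top_of_isPushout (isPushout_appTop_of_isPullback hc) _ (fun s => ?_)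
      (fun s => ?_)
    · have h1 : (pullback.fst ((U.ι ≫ f) ≫ g) (W.ι ≫ g)).appTop ≫ δ.appTop ≫ e.hom =
          U.topIso.hom ≫ X.presheaf.map (homOfLE inf_le_left).op := by
        rw [← Scheme.Hom.comp_appTop_assoc, hδ1, Scheme.homOfLE_appTop]
        have h := X.presheaf.map_comp (eqToIso U.ι_image_top.symm).op.hom
          (homOfLE (inf_le_left : U ⊓ f ⁻¹ᵁ W ≤ U)).op
        exact (X.presheaf.map_comp _ _).symm.trans h
      have h2 := hTU (U.topIso.hom s)
      rw [← CommRingCat.comp_apply, ← h1] at h2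
      exact h2
    · have h1 : (pullback.snd ((U.ι ≫ f) ≫ g) (W.ι ≫ g)).appTop ≫ δ.appTop ≫ e.hom =
          W.topIso.hom ≫ f.appLE W (U ⊓ f ⁻¹ᵁ W) inf_le_right := by
        rw [← Scheme.Hom.comp_appTop_assoc, hδ2, Scheme.Hom.appTop, Scheme.Hom.resLE_app_top,
          Category.assoc, Category.assoc, Iso.inv_hom_id, Category.comp_id]
      have h2 := hTW (W.topIso.hom s)
      rw [← CommRingCat.comp_apply, ← h1] at h2
      exact h2
  refine top_le_iff.1 fun x _ => ?_
  obtain ⟨y, hy⟩ := hsurj (e.inv x)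
  have hy' : y ∈ (T.comap e.hom.hom).comap δ.appTop.hom := hT' ▸ Subring.mem_top y
  have : e.hom (δ.appTop y) ∈ T := hy'
  rw [hy] at this
  simpa using this

end HeightRatio

end

noncomputable section

namespace HeightRatio

/-! ### Coordinate ratios on projective space -/

section Ratios

variable {k : Type u} [Field k] {n : ℕ}

open HomogeneousLocalization

lemma res_res {X : Scheme.{u}} {U V W : X.Opens} (h : W ≤ V) (h' : V ≤ U) (s : Γ(X, U)) :
    X.presheaf.map (homOfLE h).op (X.presheaf.map (homOfLE h').op s) =
      X.presheaf.map (homOfLE (h.trans h')).op s := by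
  rw [← CommRingCat.comp_apply, ← Functor.map_comp]
  rfl

/-- The fraction `ℓ / Xⱼ` in the degree zero part of the localization at `Xⱼ`. -/
def awayRatio (ℓ : grading k n 1) (j : Fin (n + 1)) :
    Away (grading k n) (MvPolynomial.X j : MvPolynomial (Fin (n + 1)) k) :=
  Away.mk (grading k n) (X_mem_grading k n j) 1 ℓ.1 (by simp)

lemma ratio_eq (ℓ : grading k n 1) (j : Fin (n + 1)) :
    ratio ℓ j = Proj.awayToSection (grading k n) (MvPolynomial.X j) (awayRatio ℓ j) := rfl

lemma val_awayRatio (ℓ : grading k n 1) (j : Fin (n + 1)) :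
    (awayRatio ℓ j).val = Localization.mk ℓ.1 ⟨MvPolynomial.X j, Submonoid.mem_powers _⟩ := by
  rw [awayRatio, Away.val_mk]; congr 2; simp

lemma val_awayMap_awayRatio (ℓ : grading k n 1) (i j : Fin (n + 1))
    {x : MvPolynomial (Fin (n + 1)) k} (hx : x = MvPolynomial.X j * MvPolynomial.X i) :
    (awayMap (grading k n) (X_mem_grading k n i) hx (awayRatio ℓ j)).val =
      Localization.mk (ℓ.1 * MvPolynomial.X i) ⟨x, Submonoid.mem_powers _⟩ := by
  have h := val_awayMap_mk (grading k n) (X_mem_grading k n i) hx (1 • 1)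
    ⟨ℓ.1, by simp⟩ 1 (SetLike.pow_mem_graded 1 (X_mem_grading k n j))
  refine Eq.trans h ?_
  simp only [pow_one]

lemma ratio_self (j : Fin (n + 1)) : ratio (coordForm k n j) j = 1 := by
  rw [ratio_eq]
  convert map_one (Proj.awayToSection (grading k n) (MvPolynomial.X j)).hom
  refine val_injective _ ?_
  rw [val_awayRatio, val_one]
  exact Localization.mk_self_mk _ _
 
lemma awayRatio_mul_awayRatio (ℓ : grading k n 1) (i j : Fin (n + 1)) :
    awayMap (grading k n) (X_mem_grading k n i) rfl (awayRatio ℓ j) *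
      awayMap (grading k n) (X_mem_grading k n j) (mul_comm _ _) (awayRatio (coordForm k n j) i) =
    awayMap (grading k n) (X_mem_grading k n j) (mul_comm (MvPolynomial.X j) (MvPolynomial.X i))
      (awayRatio ℓ i) := by
  refine val_injective _ ?_
  rw [val_mul, val_awayMap_awayRatio, val_awayMap_awayRatio, val_awayMap_awayRatio,
    Localization.mk_mul, Localization.mk_eq_mk_iff, Localization.r_iff_exists]
  refine ⟨1, ?_⟩
  simp only [coordForm, Submonoid.coe_mul]
  ring

lemma ratio_mul_ratio (ℓ : grading k n 1) (i j : Fin (n + 1)) {W : (ProjSpace k n).Opens}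
    (hj : W ≤ chart k n j) (hi : W ≤ chart k n i) :
    (ProjSpace k n).presheaf.map (homOfLE hj).op (ratio ℓ j) *
      (ProjSpace k n).presheaf.map (homOfLE hi).op (ratio (coordForm k n j) i) =
    (ProjSpace k n).presheaf.map (homOfLE hi).op (ratio ℓ i) := by
  have hW : W ≤ Proj.basicOpen (grading k n) (MvPolynomial.X j * MvPolynomial.X i) := by
    rw [Proj.basicOpen_mul]; exact le_inf hj hi
  have h (ℓ : grading k n 1) (i j : Fin (n + 1)) {x : MvPolynomial (Fin (n + 1)) k}
      (hx : x = MvPolynomial.X j * MvPolynomial.X i) (hW : W ≤ Proj.basicOpen (grading k n) x)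
      (hj : W ≤ chart k n j) :
      (ProjSpace k n).presheaf.map (homOfLE hj).op (ratio ℓ j) =
        (ProjSpace k n).presheaf.map (homOfLE hW).op (Proj.awayToSection (grading k n) x
          (awayMap (grading k n) (X_mem_grading k n i) hx (awayRatio ℓ j))) := by
    have h1 := congrArg (fun f => f.hom (awayRatio ℓ j))
      (Proj.awayMap_awayToSection (grading k n) (X_mem_grading k n i) hx)
    simp only [CommRingCat.hom_comp, RingHom.comp_apply] at h1
    have h2 := congrArg (fun s => (ProjSpace k n).presheaf.map (homOfLE hW).op s) h1
    refine Eq.trans ?_ h2.symm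
    rw [ratio_eq]
    exact (res_res _ _ _).symm
  rw [h ℓ i j rfl hW hj, h (coordForm k n j) j i (mul_comm _ _) hW hi,
    h ℓ j i (mul_comm _ _) hW hi, ← map_mul, ← map_mul, awayRatio_mul_awayRatio]

lemma X_notMem_of_isUnit_awayRatio {p : Ideal (MvPolynomial (Fin (n + 1)) k)} [p.IsPrime] (i j : Fin (n + 1))
    (hj : Submonoid.powers (MvPolynomial.X j : MvPolynomial (Fin (n + 1)) k) ≤ p.primeCompl)
    (h : IsUnit (HomogeneousLocalization.mapId (grading k n) hj (awayRatio (coordForm k n i) j))) :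
    MvPolynomial.X i ∉ p := by
  have h1 := h.map
    (algebraMap (HomogeneousLocalization.AtPrime (grading k n) p) (Localization.AtPrime p))
  rw [HomogeneousLocalization.algebraMap_apply] at h1
  have h2 : (HomogeneousLocalization.mapId (grading k n) hj (awayRatio (coordForm k n i) j)).val =
    IsLocalization.mk' _ (MvPolynomial.X i) ⟨MvPolynomial.X j, hj (Submonoid.mem_powers _)⟩ := by
    have h3 : awayRatio (coordForm k n i) j = mk ⟨1, coordForm k n i,
        ⟨MvPolynomial.X j, X_mem_grading k n j⟩, Submonoid.mem_powers _⟩ := by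
      refine val_injective _ ?_
      rw [val_awayRatio, val_mk]
    rw [h3]
    exact Localization.mk_eq_mk'_apply _ _
  rw [h2, IsLocalization.AtPrime.isUnit_mk'_iff] at h1
  exact h1

lemma basicOpen_ratio (i j : Fin (n + 1)) :
    (ProjSpace k n).basicOpen (ratio (coordForm k n i) j) = chart k n j ⊓ chart k n i := by
  ext x
  constructor
  · intro h
    have hj : x ∈ chart k n j := (ProjSpace k n).basicOpen_le _ h
    refine ⟨hj, ?_⟩
    rw [SetLike.mem_coe, Scheme.mem_basicOpen _ _ _ hj] at h
    have h2 := congrArg (fun f => f.hom (awayRatio (coordForm k n i) j))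
      (ProjectiveSpectrum.Proj.awayToSection_germ (grading k n) (MvPolynomial.X j) x hj)
    have h3 : IsUnit ((AlgebraicGeometry.Proj.stalkIso' (grading k n) x).symm
        (HomogeneousLocalization.mapId (grading k n) (Submonoid.powers_le.mpr hj)
          (awayRatio (coordForm k n i) j))) := by
      refine Eq.mp (congrArg IsUnit ?_) h
      exact h2
    rw [MulEquiv.isUnit_map] at h3
    have := x.isPrime
    exact X_notMem_of_isUnit_awayRatio i j _ h3
  · rintro ⟨hj, hi⟩
    rw [SetLike.mem_coe, Scheme.mem_basicOpen _ _ _ hj]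
    -- On the intersection, `Xᵢ / Xⱼ` has inverse `Xⱼ / Xᵢ`.
    have h := ratio_mul_ratio (coordForm k n j) j i (W := chart k n i ⊓ chart k n j)
      inf_le_left inf_le_right
    rw [ratio_self, map_one] at h
    have hx : x ∈ chart k n i ⊓ chart k n j := ⟨hi, hj⟩
    have h1 := congrArg ((ProjSpace k n).presheaf.germ (chart k n i ⊓ chart k n j) x hx) h
    rw [map_mul, map_one] at h1
    rw [TopCat.Presheaf.germ_res_apply, TopCat.Presheaf.germ_res_apply] at h1
    exact IsUnit.of_mul_eq_one_right _ h1

lemma appLE_top_eq {X Y : Scheme.{u}} (g : X ⟶ Y) (U : X.Opens) :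
    g.appLE ⊤ U le_top = (U.ι ≫ g).appTop ≫ U.topIso.hom := by
  rw [Scheme.Hom.comp_appTop, Category.assoc]
  have h : U.ι.appTop ≫ U.topIso.hom = X.presheaf.map (homOfLE le_top).op :=
    (congrArg (· ≫ U.topIso.hom) (Scheme.Opens.ι_appTop U)).trans
      ((X.presheaf.map_comp _ _).symm.trans rfl)
  rw [h]
  rfl

/-- The constants in `Γ(X, U)`, for a `k`-scheme `π : X ⟶ Spec k`. -/
def constHom {X : Scheme.{u}} (π : X ⟶ Spec (.of k)) (U : X.Opens) : k →+* Γ(X, U) :=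
  (π.appLE ⊤ U le_top).hom.comp (Scheme.ΓSpecIso (.of k)).inv.hom

lemma res_constHom {X : Scheme.{u}} (π : X ⟶ Spec (.of k)) {U W : X.Opens} (h : W ≤ U) (c : k) :
    X.presheaf.map (homOfLE h).op (constHom π U c) = constHom π W c := by
  have := Scheme.Hom.appLE_map π (U := ⊤) (V := U) le_top (homOfLE h).op
  exact congrArg (fun f => f.hom ((Scheme.ΓSpecIso (.of k)).inv c)) this

lemma appLE_constHom {X Y : Scheme.{u}} (f : X ⟶ Y) (π : Y ⟶ Spec (.of k)) (U : X.Opens)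
    (W : Y.Opens) (h : U ≤ f ⁻¹ᵁ W) (c : k) :
    f.appLE W U h (constHom π W c) = constHom (f ≫ π) U c := by
  have := Scheme.Hom.appLE_comp_appLE f π ⊤ W U le_top h
  exact congrArg (fun f => f.hom ((Scheme.ΓSpecIso (.of k)).inv c)) this

lemma chart_ι_toSpecZero (j : Fin (n + 1)) :
    (chart k n j).ι ≫ Proj.toSpecZero (grading k n) =
      Proj.basicOpenToSpec (grading k n) (MvPolynomial.X j) ≫
        Spec.map (CommRingCat.ofHom (fromZeroRingHom (grading k n) _)) := by
  rw [← Proj.awayι_toSpecZero (grading k n) (MvPolynomial.X j) (X_mem_grading k n j) one_pos,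
    Proj.awayι, ← Proj.basicOpenIsoSpec_hom (grading k n) (MvPolynomial.X j)
      (X_mem_grading k n j) one_pos, Category.assoc, Iso.hom_inv_id_assoc]

/-- Reconciles the constants coming from the structure morphism with the degree zero constants of
the graded ring. -/
lemma constHom_chart (j : Fin (n + 1)) (c : k) :
    constHom (ProjSpace.toSpec k n) (chart k n j) c =
      Proj.awayToSection (grading k n) (MvPolynomial.X j)
        (fromZeroRingHom (grading k n) _ (algebraMap k (grading k n 0) c)) := by
  have h : (chart k n j).ι ≫ ProjSpace.toSpec k n =
      Proj.basicOpenToSpec (grading k n) (MvPolynomial.X j) ≫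
        Spec.map (CommRingCat.ofHom ((fromZeroRingHom (grading k n) _).comp
          (algebraMap k (grading k n 0)))) := by
    rw [ProjSpace.toSpec, ← Category.assoc, chart_ι_toSpecZero, Category.assoc, ← Spec.map_comp]
    rfl
  have h2 : (Scheme.ΓSpecIso (.of k)).inv ≫ (ProjSpace.toSpec k n).appLE ⊤ (chart k n j) le_top =
      CommRingCat.ofHom ((fromZeroRingHom (grading k n) _).comp (algebraMap k (grading k n 0))) ≫
        Proj.awayToSection (grading k n) (MvPolynomial.X j) := by
    rw [appLE_top_eq, h, Scheme.Hom.comp_appTop, Iso.inv_comp_eq,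
      show (Proj.basicOpenToSpec (grading k n) (MvPolynomial.X j)).appTop = _ from
        Proj.basicOpenToSpec_app_top (grading k n) (MvPolynomial.X j), Category.assoc,
      Category.assoc, Category.assoc, Iso.inv_hom_id, Category.comp_id,
      ← Scheme.ΓSpecIso_naturality_assoc]
  exact congrArg (fun f => f.hom c) h2

/-- Dehomogenization: every monomial of `p` has total degree `d`, so the factor `Xⱼ^d` can be
distributed over its variables. -/
lemma away_mk_eq_sum (j : Fin (n + 1)) (d : ℕ) (p : MvPolynomial (Fin (n + 1)) k)
    (hp : p ∈ grading k n (d • 1)) :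
    Away.mk (grading k n) (X_mem_grading k n j) d p hp =
      ∑ m ∈ p.support, fromZeroRingHom (grading k n) _ (algebraMap k (grading k n 0) (p.coeff m)) *
        ∏ i, awayRatio (coordForm k n i) j ^ m i := by
  have hd : p.IsHomogeneous d := by simpa using hp
  set S := Submonoid.powers (MvPolynomial.X j : MvPolynomial (Fin (n + 1)) k)
  let xj : S := ⟨MvPolynomial.X j, Submonoid.mem_powers _⟩
  let a := algebraMap (MvPolynomial (Fin (n + 1)) k) (Localization S)
  have hu : IsUnit (a (MvPolynomial.X j)) := IsLocalization.map_units (Localization S) xj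
  have hX (i : Fin (n + 1)) :
      a (MvPolynomial.X j) * (awayRatio (coordForm k n i) j).val = a (MvPolynomial.X i) := by
    rw [val_awayRatio, Localization.mk_eq_mk'_apply]
    exact IsLocalization.mk'_spec' (Localization S) (MvPolynomial.X i) xj
  refine val_injective _ ((hu.pow d).mul_left_cancel ?_)
  have hleft : a (MvPolynomial.X j) ^ d *
      (Away.mk (grading k n) (X_mem_grading k n j) d p hp).val = a p := by
    rw [Away.val_mk, Localization.mk_eq_mk'_apply, ← map_pow]
    exact IsLocalization.mk'_spec' (Localization S) p (xj ^ d)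
  rw [hleft, ← HomogeneousLocalization.algebraMap_apply, map_sum, Finset.mul_sum]
  conv_lhs => rw [p.as_sum, map_sum]
  refine Finset.sum_congr rfl fun m hm => ?_
  have hm' : ∑ i, m i = d := by
    have := hd (MvPolynomial.mem_support_iff.1 hm)
    rw [Finsupp.weight_apply, Finsupp.sum_fintype _ _ (by simp)] at this
    simpa using this
  rw [map_mul, map_prod, mul_left_comm, ← hm', ← Finset.prod_pow_eq_pow_sum,
    ← Finset.prod_mul_distrib, MvPolynomial.monomial_eq, map_mul, Finsupp.prod_fintype _ _ (by simp),
    map_prod]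
  congr 1
  refine Finset.prod_congr rfl fun i _ => ?_
  rw [map_pow, map_pow, ← mul_pow, HomogeneousLocalization.algebraMap_apply, hX]

/-- The ring of functions on a standard chart is generated by the coordinate ratios. -/
lemma generatedBy_ratio (j : Fin (n + 1)) :
    GeneratedBy (constHom (ProjSpace.toSpec k n) (chart k n j))
      (Set.range fun l => ratio (coordForm k n l) j) := by
  refine generatedBy_of_forall fun T hc hr => top_le_iff.1 fun s _ => ?_
  let e := Proj.basicOpenIsoAway (grading k n) (MvPolynomial.X j) (X_mem_grading k n j) one_pos
  have he : e.hom = Proj.awayToSection (grading k n) (MvPolynomial.X j) := rfl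
  obtain ⟨d, p, hp, hs⟩ := Away.mk_surjective (grading k n) (X_mem_grading k n j) (e.inv s)
  have hs' : s = Proj.awayToSection (grading k n) (MvPolynomial.X j)
      (Away.mk (grading k n) (X_mem_grading k n j) d p hp) := by
    rw [hs, ← he]; simp
  rw [hs', away_mk_eq_sum, map_sum]
  refine sum_mem fun m _ => ?_
  rw [map_mul, map_prod, ← constHom_chart]
  refine mul_mem (hc _) (prod_mem fun i _ => ?_)
  rw [map_pow, ← ratio_eq]
  exact pow_mem (hr ⟨i, rfl⟩) _

lemma isAffineOpen_chart (j : Fin (n + 1)) : IsAffineOpen (chart k n j) :=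
  Proj.isAffineOpen_basicOpen _ _ (X_mem_grading k n j) one_pos

instance : IsSeparated (ProjSpace.toSpec k n) := by
  unfold ProjSpace.toSpec
  infer_instance

end Ratios

end HeightRatio

end

noncomputable section

namespace HeightRatio

/-! ### Values of sections at field-valued points -/

section Evaluation

variable {X : Scheme.{u}} {L : Type u} [Field L]

/-- `evalAt` as a ring homomorphism. -/
def evalHom (p : Spec (.of L) ⟶ X) (U : X.Opens) (hU : ⊤ ≤ p ⁻¹ᵁ U) : Γ(X, U) →+* L :=
  (Scheme.ΓSpecIso (.of L)).hom.hom.comp (p.appLE U ⊤ hU).hom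

lemma evalAt_eq (p : Spec (.of L) ⟶ X) (U : X.Opens) (hU : ⊤ ≤ p ⁻¹ᵁ U) (s : Γ(X, U)) :
    evalAt p U hU s = evalHom p U hU s := rfl

lemma evalHom_res (p : Spec (.of L) ⟶ X) {U W : X.Opens} (h : W ≤ U) (hW : ⊤ ≤ p ⁻¹ᵁ W)
    (hU : ⊤ ≤ p ⁻¹ᵁ U) (s : Γ(X, U)) :
    evalHom p W hW (X.presheaf.map (homOfLE h).op s) = evalHom p U hU s := by
  have := Scheme.Hom.map_appLE p (U := W) (V := ⊤) hW (homOfLE h).op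
  exact congrArg (fun f => (Scheme.ΓSpecIso (.of L)).hom (f.hom s)) this

lemma evalHom_appLE {Y : Scheme.{u}} (p : Spec (.of L) ⟶ X) (f : X ⟶ Y) {U : X.Opens} {W : Y.Opens}
    (h : U ≤ f ⁻¹ᵁ W) (hU : ⊤ ≤ p ⁻¹ᵁ U) (hW : ⊤ ≤ (p ≫ f) ⁻¹ᵁ W) (s : Γ(Y, W)) :
    evalHom p U hU (f.appLE W U h s) = evalHom (p ≫ f) W hW s := by
  have := Scheme.Hom.appLE_comp_appLE p f W U ⊤ h hU
  exact congrArg (fun f => (Scheme.ΓSpecIso (.of L)).hom (f.hom s)) this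

lemma evalHom_constHom {k : Type u} [Field k] [Algebra k L] (π : X ⟶ Spec (.of k))
    (p : Spec (.of L) ⟶ X) (hp : p ≫ π = Spec.map (CommRingCat.ofHom (algebraMap k L)))
    (U : X.Opens) (hU : ⊤ ≤ p ⁻¹ᵁ U) (c : k) :
    evalHom p U hU (constHom π U c) = algebraMap k L c := by
  have h1 := Scheme.Hom.appLE_comp_appLE p π ⊤ U ⊤ le_top hU
  have h2 : (Scheme.ΓSpecIso (.of k)).inv ≫ (π.appLE ⊤ U le_top ≫ p.appLE U ⊤ hU) ≫
      (Scheme.ΓSpecIso (.of L)).hom = CommRingCat.ofHom (algebraMap k L) := by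
    rw [h1, hp, Iso.inv_comp_eq, ← Scheme.ΓSpecIso_naturality]
    congr 1
  exact congrArg (fun f => f.hom c) h2

lemma top_le_preimage_iff (p : Spec (.of L) ⟶ X) (U : X.Opens) :
    ⊤ ≤ p ⁻¹ᵁ U ↔ p (⊥ : PrimeSpectrum L) ∈ U := by
  refine ⟨fun h => h (Set.mem_univ _), fun h y _ => ?_⟩
  have : y = (⊥ : PrimeSpectrum L) := Subsingleton.elim (α := PrimeSpectrum L) _ _
  rw [this]
  exact h

lemma evalHom_ne_zero_iff (p : Spec (.of L) ⟶ X) (U : X.Opens) (hU : ⊤ ≤ p ⁻¹ᵁ U) (s : Γ(X, U)) :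
    evalHom p U hU s ≠ 0 ↔ ⊤ ≤ p ⁻¹ᵁ X.basicOpen s := by
  have h1 := Scheme.basicOpen_appLE p ⊤ U hU s
  rw [top_inf_eq] at h1
  have h2 := basicOpen_eq_of_affine' (R := .of L) (p.appLE U ⊤ hU s)
  rw [← h1, h2]
  refine ⟨fun h y _ => ?_, fun h h0 => ?_⟩
  · have : y = (⊥ : PrimeSpectrum L) := Subsingleton.elim (α := PrimeSpectrum L) _ _
    rw [this]
    exact h
  · have h3 := h (Set.mem_univ (⊥ : PrimeSpectrum L))
    exact h3 h0

variable {k : Type u} [Field k] {n : ℕ}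

lemma homCoords_ne_zero (p : Spec (.of L) ⟶ ProjSpace k n) : homCoords p ≠ 0 := by
  refine Function.ne_iff.2 ⟨(exists_chart p).choose, ?_⟩
  rw [homCoords, ratio_self, evalAt_eq, map_one]
  exact one_ne_zero

lemma homCoords_ne_zero_iff (p : Spec (.of L) ⟶ ProjSpace k n) (j : Fin (n + 1)) :
    homCoords p j ≠ 0 ↔ ⊤ ≤ p ⁻¹ᵁ chart k n j := by
  rw [homCoords, evalAt_eq, evalHom_ne_zero_iff, basicOpen_ratio]
  exact ⟨fun h => h.trans fun _ hx => hx.2, fun h => le_inf (exists_chart p).choose_spec h⟩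

lemma evalHom_ratio_mul (p : Spec (.of L) ⟶ ProjSpace k n) (ℓ : grading k n 1) (i j : Fin (n + 1))
    (hj : ⊤ ≤ p ⁻¹ᵁ chart k n j) (hi : ⊤ ≤ p ⁻¹ᵁ chart k n i) :
    evalHom p _ hj (ratio ℓ j) * evalHom p _ hi (ratio (coordForm k n j) i) =
      evalHom p _ hi (ratio ℓ i) := by
  have hW : ⊤ ≤ p ⁻¹ᵁ (chart k n j ⊓ chart k n i) := le_inf hj hi
  rw [← evalHom_res p inf_le_left hW hj, ← evalHom_res p inf_le_right hW hi,
    ← evalHom_res p inf_le_right hW hi, ← map_mul, ratio_mul_ratio]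

/-- On every chart containing the point the coordinate ratios are proportional to `homCoords`, so
the chart chosen in its definition is immaterial. -/
lemma evalHom_ratio_mul_homCoords (p : Spec (.of L) ⟶ ProjSpace k n) (l j : Fin (n + 1))
    (hj : ⊤ ≤ p ⁻¹ᵁ chart k n j) :
    evalHom p _ hj (ratio (coordForm k n l) j) * homCoords p j = homCoords p l :=
  evalHom_ratio_mul p _ _ _ hj _

end Evaluation

end HeightRatio

end

noncomputable section

namespace HeightRatio

/-! ### Heights of morphisms are bounded by the height of an embedding -/

section UpperBound

instance charZero_algebraicClosure (k : Type u) [Field k] [CharZero k] :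
    CharZero (AlgebraicClosure k) :=
  charZero_of_injective_algebraMap (algebraMap k (AlgebraicClosure k)).injective

instance isAlgebraic_rat_algebraicClosure (k : Type u) [Field k] [CharZero k]
    [Algebra.IsAlgebraic ℚ k] : Algebra.IsAlgebraic ℚ (AlgebraicClosure k) :=
  Algebra.IsAlgebraic.trans ℚ k (AlgebraicClosure k)

lemma GeneratedBy.map_of_surjective {k R R' : Type*} [CommRing k] [CommRing R] [CommRing R']
    {c : k →+* R} {S : Set R} (h : GeneratedBy c S) (f : R →+* R') (hf : Function.Surjective f) :
    GeneratedBy (f.comp c) (f '' S) := by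
  refine generatedBy_of_forall fun T hc hS => top_le_iff.1 fun r _ => ?_
  obtain ⟨r, rfl⟩ := hf r
  have : T.comap f = ⊤ := h.eq_top _ hc fun s hs => hS ⟨s, hs, rfl⟩
  exact (this ▸ Subring.mem_top r : r ∈ T.comap f)

lemma eval_tensorPow {R R' ι : Type*} [CommRing R] [CommRing R'] (f : R →+* R') (w : ι → R) (M : ℕ)
    (s : Fin M → ι) : f (tensorPow w M s) = tensorPow (fun i => f (w i)) M s := by
  simp [tensorPow]

lemma absLogHeight_evalHom_ratio {k L : Type u} [Field k] [Field L] [CharZero L]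
    [Algebra.IsAlgebraic ℚ L] {n : ℕ} (p : Spec (.of L) ⟶ ProjSpace k n) (j : Fin (n + 1))
    (hj : ⊤ ≤ p ⁻¹ᵁ chart k n j) :
    absLogHeight (fun l => evalHom p _ hj (ratio (coordForm k n l) j)) =
      absLogHeight (homCoords p) := by
  have hne := (homCoords_ne_zero_iff p j).2 hj
  rw [← absLogHeight_smul _ hne]
  congr 1
  ext l
  rw [Pi.smul_apply, smul_eq_mul, mul_comm, evalHom_ratio_mul_homCoords]

variable {k : Type u} [Field k] {V : Scheme.{u}} {π : V ⟶ Spec (.of k)}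

lemma exists_mem_preimage_chart {n : ℕ} (φ : V ⟶ ProjSpace k n) (x : V) :
    ∃ j, x ∈ φ ⁻¹ᵁ chart k n j := by
  have hx : φ x ∈ ⨆ j, chart k n j := by rw [iSup_chart]; trivial
  obtain ⟨j, hj⟩ := TopologicalSpace.Opens.mem_iSup.1 hx
  exact ⟨j, hj⟩

/-- The pullback of the `l`-th coordinate ratio on the `j`-th chart. -/
def pullRatio {n : ℕ} (φ : V ⟶ ProjSpace k n) {U : V.Opens} {j : Fin (n + 1)}
    (hU : U ≤ φ ⁻¹ᵁ chart k n j) (l : Fin (n + 1)) : Γ(V, U) :=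
  φ.appLE (chart k n j) U hU (ratio (coordForm k n l) j)

lemma pullRatio_self {n : ℕ} (φ : V ⟶ ProjSpace k n) {U : V.Opens} {j : Fin (n + 1)}
    (hU : U ≤ φ ⁻¹ᵁ chart k n j) : pullRatio φ hU j = 1 := by
  rw [pullRatio, ratio_self, map_one]

lemma evalHom_pullRatio {L : Type u} [Field L] (P : Spec (.of L) ⟶ V) {n : ℕ}
    (φ : V ⟶ ProjSpace k n) {U : V.Opens} {j : Fin (n + 1)} (hU : U ≤ φ ⁻¹ᵁ chart k n j)
    (hP : ⊤ ≤ P ⁻¹ᵁ U) (l : Fin (n + 1)) :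
    evalHom P U hP (pullRatio φ hU l) =
      evalHom (P ≫ φ) (chart k n j) (hP.trans fun _ hx => hU hx) (ratio (coordForm k n l) j) :=
  evalHom_appLE P φ hU hP _ _

lemma generatedBy_pullRatio {r : ℕ} (i : V ⟶ ProjSpace k r) [IsClosedImmersion i]
    (hi : i ≫ ProjSpace.toSpec k r = π) (q : Fin (r + 1)) :
    GeneratedBy (constHom π (i ⁻¹ᵁ chart k r q)) (Set.range (pullRatio i (j := q) le_rfl)) := by
  have h := (generatedBy_ratio (k := k) q).map_of_surjective (i.app (chart k r q)).hom
    (i.app_surjective _ (isAffineOpen_chart q))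
  have h1 : (i.app (chart k r q)).hom.comp (constHom (ProjSpace.toSpec k r) (chart k r q)) =
      constHom π (i ⁻¹ᵁ chart k r q) := by
    subst hi
    ext c
    have := appLE_constHom i (ProjSpace.toSpec k r) (i ⁻¹ᵁ chart k r q) (chart k r q) le_rfl c
    rw [Scheme.Hom.appLE_eq_app] at this
    exact this
  rw [h1, ← Set.range_comp] at h
  convert h using 2
  ext l
  rw [pullRatio, Scheme.Hom.appLE_eq_app]
  rfl

variable [CharZero k] [Algebra.IsAlgebraic ℚ k]

/-- On a small basic open `D(g)` of a chart of `i`, the coordinate ratios of `φ` are `p_l / g^e`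
with a common denominator, and the `p_l` are forms of a common degree in the coordinate ratios of
`i`. -/
lemma exists_nhds_mapHeight_le {r n : ℕ} (i : V ⟶ ProjSpace k r) [IsClosedImmersion i]
    (hi : i ≫ ProjSpace.toSpec k r = π) (φ : V ⟶ ProjSpace k n) (x : V) :
    ∃ O : V.Opens, x ∈ O ∧ ∃ (N : ℕ) (C : ℝ), ∀ P : GeomPoint π, ⊤ ≤ P.1 ⁻¹ᵁ O →
      mapHeight φ P ≤ N * mapHeight i P + C := by
  obtain ⟨q, hq⟩ := exists_mem_preimage_chart i x
  obtain ⟨j, hj⟩ := exists_mem_preimage_chart φ x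
  have hT : IsAffineOpen (i ⁻¹ᵁ chart k r q) := (isAffineOpen_chart q).preimage i
  obtain ⟨g, hg, hxg⟩ := hT.exists_basicOpen_le ⟨x, hj⟩ hq
  have hloc := hT.isLocalization_basicOpen g
  obtain ⟨⟨b, e, rfl⟩, hb⟩ := IsLocalization.exist_integer_multiples_of_finite
    (Submonoid.powers g) (S := Γ(V, V.basicOpen g)) (fun l => pullRatio φ hg l)
  choose p hp using hb
  have hw := pullRatio_self i (U := i ⁻¹ᵁ chart k r q) (j := q) le_rfl
  choose N hN using fun l => (generatedBy_pullRatio i hi q).exists_forms hw (p l)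
  obtain ⟨M, hM⟩ : ∃ M, ∀ l, N l ≤ M :=
    ⟨Finset.univ.sup N, fun l => Finset.le_sup (Finset.mem_univ l)⟩
  choose A hA using fun l => hN l M (hM l)
  obtain ⟨C, hC⟩ := absLogHeight_le_of_forms (F := AlgebraicClosure k)
    (fun ls : Fin (n + 1) × (Fin M → Fin (r + 1)) =>
      algebraMap k (AlgebraicClosure k) (A ls.1 ls.2))
  refine ⟨V.basicOpen g, hxg, M, C, fun P hP => ?_⟩
  have hle := V.basicOpen_le g
  have hPT : ⊤ ≤ P.1 ⁻¹ᵁ (i ⁻¹ᵁ chart k r q) := hP.trans fun _ hx => hle hx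
  have hPj : ⊤ ≤ (P.1 ≫ φ) ⁻¹ᵁ chart k n j := hP.trans fun _ hx => hg hx
  have hg0 : evalHom P.1 _ hPT g ≠ 0 := (evalHom_ne_zero_iff _ _ _ _).2 hP
  have key := hC (fun l => evalHom P.1 _ hPT (pullRatio i le_rfl l))
    (fun l => evalHom P.1 _ hP (pullRatio φ hg l)) (evalHom P.1 _ hPT g ^ e)
    (Function.ne_iff.2 ⟨q, by rw [hw, map_one]; exact one_ne_zero⟩) (pow_ne_zero e hg0) (fun l => ?_)
  · simp only [evalHom_pullRatio] at key
    rw [absLogHeight_evalHom_ratio, absLogHeight_evalHom_ratio] at key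
    exact key
  · have h1 := congrArg (evalHom P.1 _ hPT) (hA l)
    simp only [map_sum, map_mul, evalHom_constHom π P.1 P.2, eval_tensorPow] at h1
    rw [← h1, ← evalHom_res P.1 hle hP hPT, ← evalHom_res P.1 hle hP hPT, ← map_pow, ← map_mul]
    congr 1
    have h2 := hp l
    rw [Algebra.smul_def, map_pow] at h2
    exact h2.symm

/-- The height of a morphism is bounded in terms of the height of a closed embedding. -/
theorem exists_mapHeight_le {r n : ℕ} (i : V ⟶ ProjSpace k r) [IsClosedImmersion i]
    (hi : i ≫ ProjSpace.toSpec k r = π) (φ : V ⟶ ProjSpace k n) :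
    ∃ (N : ℕ) (C : ℝ), ∀ P : GeomPoint π, mapHeight φ P ≤ N * mapHeight i P + C := by
  choose O hO N C h using exists_nhds_mapHeight_le (π := π) i hi φ
  have : CompactSpace V := by
    refine ⟨?_⟩
    have h := isCompact_iUnion fun q => ((isAffineOpen_chart (k := k) q).preimage i).isCompact
    convert h
    exact (Set.eq_univ_of_forall fun x =>
      Set.mem_iUnion.2 (exists_mem_preimage_chart i x)).symm
  obtain ⟨t, ht⟩ := isCompact_univ.elim_finite_subcover (fun x => (O x : Set V))
    (fun x => (O x).2) (fun x _ => Set.mem_iUnion.2 ⟨x, hO x⟩)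
  -- Enlarging the local slopes to their maximum is harmless because `mapHeight i` is nonnegative.
  refine ⟨t.sup N, ∑ x ∈ t, |C x|, fun P => ?_⟩
  obtain ⟨x, hx, hPx⟩ := Set.mem_iUnion₂.1 (ht (Set.mem_univ (P.1 (⊥ : PrimeSpectrum _))))
  refine (h x P ((top_le_preimage_iff _ _).2 hPx)).trans (add_le_add ?_ ?_)
  · refine mul_le_mul_of_nonneg_right ?_ (absLogHeight_nonneg _)
    exact_mod_cast Finset.le_sup (f := N) hx
  · exact (le_abs_self _).trans
      (Finset.single_le_sum (f := fun x => |C x|) (fun _ _ => abs_nonneg _) hx)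

end UpperBound

end HeightRatio

end

noncomputable section

namespace HeightRatio

/-! ### Rational functions which are regular on an open set -/

section RationalFunctions

variable {V : Scheme.{u}} [IsIntegral V]

/-- A section over an open set containing the generic point, as a rational function. -/
def toFunctionField (U : V.Opens) (hU : genericPoint V ∈ U) : Γ(V, U) →+* V.functionField :=
  (V.presheaf.germ U (genericPoint V) hU).hom

lemma genericPoint_mem_of_mem {U : V.Opens} {x : V} (hx : x ∈ U) : genericPoint V ∈ U :=
  ((genericPoint_spec V).mem_open_set_iff U.isOpen).2 ⟨x, trivial, hx⟩

lemma toFunctionField_injective (U : V.Opens) (hU : genericPoint V ∈ U) :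
    Function.Injective (toFunctionField U hU) :=
  germ_injective_of_isIntegral V _ hU

lemma toFunctionField_res {U W : V.Opens} (h : W ≤ U) (hW : genericPoint V ∈ W) (s : Γ(V, U)) :
    toFunctionField W hW (V.presheaf.map (homOfLE h).op s) = toFunctionField U (h hW) s :=
  TopCat.Presheaf.germ_res_apply V.presheaf (homOfLE h) _ hW s

lemma algebraMap_germ {U : V.Opens} {x : V} (hx : x ∈ U) (s : Γ(V, U)) :
    algebraMap (V.presheaf.stalk x) V.functionField (V.presheaf.germ U x hx s) =
      toFunctionField U (genericPoint_mem_of_mem hx) s := by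
  have : Nonempty U := ⟨⟨x, hx⟩⟩
  rw [Scheme.algebraMap_germ_eq_germToFunctionField]
  rfl

lemma algebraMap_stalk_injective (x : V) :
    Function.Injective (algebraMap (V.presheaf.stalk x) V.functionField) :=
  IsFractionRing.injective _ _

/-- Local sections representing `f` glue, since agreement on overlaps can be tested in the function
field. -/
lemma exists_toFunctionField_eq (U : V.Opens) (hU : genericPoint V ∈ U) (f : V.functionField)
    (h : ∀ x ∈ U, ∃ u : V.presheaf.stalk x, algebraMap _ V.functionField u = f) :
    ∃ g : Γ(V, U), toFunctionField U hU g = f := by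
  have h' (x : U) : ∃ (W : V.Opens) (_ : x.1 ∈ W) (_ : W ≤ U) (hη : genericPoint V ∈ W)
      (s : Γ(V, W)), toFunctionField W hη s = f := by
    obtain ⟨u, hu⟩ := h x.1 x.2
    obtain ⟨W, hxW, s, rfl⟩ := V.presheaf.exists_germ_eq u
    have hx : x.1 ∈ W ⊓ U := ⟨hxW, x.2⟩
    refine ⟨W ⊓ U, hx, inf_le_right, genericPoint_mem_of_mem hx,
      V.presheaf.map (homOfLE inf_le_left).op s, ?_⟩
    rw [toFunctionField_res, ← hu, algebraMap_germ]
  choose W hxW hWU hη s hs using h'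
  obtain ⟨g, hg, -⟩ := V.sheaf.existsUnique_gluing' W U (fun x => homOfLE (hWU x))
    (fun x hx => TopologicalSpace.Opens.mem_iSup.2 ⟨⟨x, hx⟩, hxW ⟨x, hx⟩⟩) s (fun x y => by
      have hxy : genericPoint V ∈ W x ⊓ W y := ⟨hη x, hη y⟩
      refine toFunctionField_injective (W x ⊓ W y) hxy ?_
      exact (toFunctionField_res inf_le_left hxy (s x)).trans
        ((hs x).trans ((hs y).symm.trans (toFunctionField_res inf_le_right hxy (s y)).symm)))
  refine ⟨g, ?_⟩
  have := hg ⟨_, hU⟩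
  rw [← hs ⟨_, hU⟩, ← this]
  exact (toFunctionField_res (hWU ⟨_, hU⟩) (hη _) g).symm

/-- A rational function which is a unit at every point of `U` is a nowhere vanishing section. -/
lemma exists_section_of_forall_unit (U : V.Opens) (hU : genericPoint V ∈ U) (f : V.functionField)
    (h : ∀ x ∈ U, ∃ u : (V.presheaf.stalk x)ˣ, algebraMap _ V.functionField u.1 = f) :
    ∃ g : Γ(V, U), toFunctionField U hU g = f ∧ V.basicOpen g = U := by
  obtain ⟨g, hg⟩ := exists_toFunctionField_eq U hU f fun x hx =>
    ⟨_, (h x hx).choose_spec⟩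
  refine ⟨g, hg, le_antisymm (V.basicOpen_le g) fun x hx => ?_⟩
  rw [Scheme.mem_basicOpen _ _ _ hx]
  obtain ⟨u, hu⟩ := h x hx
  have : V.presheaf.germ U x hx g = u := by
    refine algebraMap_stalk_injective x ?_
    rw [algebraMap_germ, hu, hg]
  rw [this]
  exact u.isUnit

end RationalFunctions

/-! ### Principal divisors and hyperplane pullbacks -/

section Divisors

variable {V : Scheme.{u}} [IsIntegral V]

variable (V) in
/-- The subgroup of principal divisors. -/
def principalDivisors : AddSubgroup (Divisor V) where
  carrier := Set.range Divisor.principal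
  zero_mem' := ⟨1, rfl⟩
  add_mem' := by rintro _ _ ⟨f, rfl⟩ ⟨g, rfl⟩; exact ⟨f * g, rfl⟩
  neg_mem' := by rintro _ ⟨f, rfl⟩; exact ⟨f⁻¹, rfl⟩

lemma linEquiv_iff (D E : Divisor V) : D.LinEquiv E ↔ D - E ∈ principalDivisors V :=
  ⟨fun ⟨f, hf⟩ => ⟨f, hf.symm⟩, fun ⟨f, hf⟩ => ⟨f, hf.symm⟩⟩

lemma nsmul_apply (D : Divisor V) (m : ℕ) (x : V) :
    (m • D).toMul.1 x = D.toMul.1 x ^ m := by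
  rw [toMul_nsmul]; rfl

variable {k : Type u} [Field k] {n s r : ℕ}

/-- The rational function `φ^*(ℓ / Xⱼ)`. -/
def ratFun (φ : V ⟶ ProjSpace k n) (ℓ : grading k n 1) {j : Fin (n + 1)}
    (hj : genericPoint V ∈ φ ⁻¹ᵁ chart k n j) : V.functionField :=
  toFunctionField _ hj (φ.app (chart k n j) (ratio ℓ j))

/-- The quotient of the local equations of `m • A` and `m • B + E` is a local equation at `x` of the
divisor of `F`, so it differs from `F` by a unit of the stalk. -/
lemma exists_unit_of_isHyperplanePullback {φ : V ⟶ ProjSpace k n} {ψ : V ⟶ ProjSpace k s}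
    {i : V ⟶ ProjSpace k r} {ℓ : grading k n 1} {ℓ' : grading k s 1} {ℓ'' : grading k r 1}
    {A B E : Divisor V} (hA : IsHyperplanePullback φ ℓ A) (hB : IsHyperplanePullback ψ ℓ' B)
    (hE : IsHyperplanePullback i ℓ'' E) {m : ℕ} {F : V.functionFieldˣ}
    (hF : m • A - (m • B + E) = Divisor.principal F) {x : V} {j l q}
    (hj : x ∈ φ ⁻¹ᵁ chart k n j) (hl : x ∈ ψ ⁻¹ᵁ chart k s l) (hq : x ∈ i ⁻¹ᵁ chart k r q) :
    ratFun φ ℓ (genericPoint_mem_of_mem hj) ≠ 0 ∧ ratFun ψ ℓ' (genericPoint_mem_of_mem hl) ≠ 0 ∧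
    ratFun i ℓ'' (genericPoint_mem_of_mem hq) ≠ 0 ∧
    ∃ u : (V.presheaf.stalk x)ˣ, algebraMap _ V.functionField u.1 =
      ratFun φ ℓ (genericPoint_mem_of_mem hj) ^ m *
        (F * (ratFun ψ ℓ' (genericPoint_mem_of_mem hl) ^ m *
          ratFun i ℓ'' (genericPoint_mem_of_mem hq)))⁻¹ := by
  obtain ⟨a, ha, hAa⟩ := hA j x hj
  obtain ⟨b, hb, hBb⟩ := hB l x hl
  obtain ⟨e, he, hEe⟩ := hE q x hq
  rw [algebraMap_germ] at ha hb he
  rw [ratFun, ratFun, ratFun, ← ha, ← hb, ← he]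
  refine ⟨a.ne_zero, b.ne_zero, e.ne_zero, ?_⟩
  have h1 : (m • A - (m • B + E)).toMul.1 x =
      (QuotientGroup.mk (a ^ m * (b ^ m * e)⁻¹) : V.functionFieldˣ ⧸ unitsAt V x) := by
    have h2 : (m • A - (m • B + E)).toMul.1 x =
        (m • A).toMul.1 x / ((m • B).toMul.1 x * E.toMul.1 x) := rfl
    rw [h2, nsmul_apply, nsmul_apply, hAa, hBb, hEe, div_eq_mul_inv]
    rfl
  rw [hF] at h1
  obtain ⟨u, hu⟩ := QuotientGroup.eq.1 (h1 : (QuotientGroup.mk F : _ ⧸ unitsAt V x) = _)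
  refine ⟨u, ?_⟩
  have h3 := congrArg Units.val hu
  have h4 : algebraMap (V.presheaf.stalk x) V.functionField u.1 = _ := h3
  rw [h4]
  push_cast
  rw [mul_inv]
  ring

lemma ratFun_mul (φ : V ⟶ ProjSpace k n) (ℓ : grading k n 1) {i j : Fin (n + 1)} {W : V.Opens}
    (hj : W ≤ φ ⁻¹ᵁ chart k n j) (hi : W ≤ φ ⁻¹ᵁ chart k n i) (hW : genericPoint V ∈ W) :
    ratFun φ ℓ (hj hW) * toFunctionField W hW (pullRatio φ hi j) = ratFun φ ℓ (hi hW) := by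
  have hO : W ≤ φ ⁻¹ᵁ (chart k n j ⊓ chart k n i) := le_inf hj hi
  have h := congrArg (φ.appLE (chart k n j ⊓ chart k n i) W hO)
    (ratio_mul_ratio ℓ i j (W := chart k n j ⊓ chart k n i) inf_le_left inf_le_right)
  rw [map_mul] at h
  have hres {j : Fin (n + 1)} (hj : W ≤ φ ⁻¹ᵁ chart k n j) {O : (ProjSpace k n).Opens}
      (hO : W ≤ φ ⁻¹ᵁ O) (h : O ≤ chart k n j) (ℓ : grading k n 1) :
      φ.appLE O W hO ((ProjSpace k n).presheaf.map (homOfLE h).op (ratio ℓ j)) =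
        φ.appLE (chart k n j) W hj (ratio ℓ j) :=
    congrArg (fun f => f.hom (ratio ℓ j)) (Scheme.Hom.map_appLE φ hO (homOfLE h).op)
  have hff {j : Fin (n + 1)} (hj : W ≤ φ ⁻¹ᵁ chart k n j) :
      toFunctionField W hW (φ.appLE (chart k n j) W hj (ratio ℓ j)) = ratFun φ ℓ (hj hW) :=
    toFunctionField_res hj hW _
  rw [hres hj hO, hres hi hO, hres hi hO] at h
  rw [← hff hj, ← hff hi, pullRatio, ← map_mul, h]

end Divisors

end HeightRatio

end

noncomputable section

namespace HeightRatio

/-! ### Comparison of heights from a linear equivalence -/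

section Comparison

variable {k : Type u} [Field k] {V : Scheme.{u}} {π : V ⟶ Spec (.of k)}

lemma res_pullRatio {n : ℕ} (φ : V ⟶ ProjSpace k n) {U W : V.Opens} {j : Fin (n + 1)}
    (hU : U ≤ φ ⁻¹ᵁ chart k n j) (h : W ≤ U) (l : Fin (n + 1)) :
    V.presheaf.map (homOfLE h).op (pullRatio φ hU l) = pullRatio φ (h.trans hU) l :=
  congrArg (fun f => f.hom (ratio (coordForm k n l) j))
    (Scheme.Hom.appLE_map φ hU (homOfLE h).op)

lemma generatedBy_inf_preimage {n : ℕ} (φ : V ⟶ ProjSpace k n)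
    (hφ : φ ≫ ProjSpace.toSpec k n = π) {U : V.Opens} (hU : IsAffineOpen U) {S : Set Γ(V, U)}
    (hS : GeneratedBy (constHom π U) S) (j : Fin (n + 1)) :
    IsAffineOpen (U ⊓ φ ⁻¹ᵁ chart k n j) ∧
      GeneratedBy (constHom π (U ⊓ φ ⁻¹ᵁ chart k n j))
        (V.presheaf.map (homOfLE inf_le_left).op '' S ∪
          Set.range (pullRatio φ (j := j) inf_le_right)) := by
  obtain ⟨h1, h2⟩ := isAffineOpen_inf_preimage φ (ProjSpace.toSpec k n) hU
    (isAffineOpen_chart (k := k) j)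
  refine ⟨h1, generatedBy_of_forall fun T hc hT => h2 T (fun s => ?_) (fun s => ?_)⟩
  · have : T.comap (V.presheaf.map (homOfLE inf_le_left).op).hom = ⊤ := by
      refine hS.eq_top _ (fun c => ?_) fun s hs => hT (.inl ⟨s, hs, rfl⟩)
      have := hc c
      rw [← res_constHom π (inf_le_left : U ⊓ φ ⁻¹ᵁ chart k n j ≤ U)] at this
      exact this
    exact (this ▸ Subring.mem_top s : s ∈ T.comap _)
  · have : T.comap (φ.appLE (chart k n j) (U ⊓ φ ⁻¹ᵁ chart k n j) inf_le_right).hom = ⊤ := by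
      refine (generatedBy_ratio j).eq_top _ (fun c => ?_) ?_
      · have := hc c
        subst hφ
        rw [← appLE_constHom φ (ProjSpace.toSpec k n) (U ⊓ φ ⁻¹ᵁ chart k n j) (chart k n j)
          inf_le_right c] at this
        exact this
      · rintro _ ⟨l, rfl⟩
        exact hT (.inr ⟨l, rfl⟩)
    exact (this ▸ Subring.mem_top s : s ∈ T.comap _)

variable {n s r : ℕ}

/-- The intersection of the preimages of three charts under three morphisms. -/
def tripleOpen (φ : V ⟶ ProjSpace k n) (ψ : V ⟶ ProjSpace k s) (i : V ⟶ ProjSpace k r)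
    (τ : Fin (n + 1) × Fin (s + 1) × Fin (r + 1)) : V.Opens :=
  (i ⁻¹ᵁ chart k r τ.2.2 ⊓ ψ ⁻¹ᵁ chart k s τ.2.1) ⊓ φ ⁻¹ᵁ chart k n τ.1

variable (φ : V ⟶ ProjSpace k n) (ψ : V ⟶ ProjSpace k s) (i : V ⟶ ProjSpace k r)
  (τ : Fin (n + 1) × Fin (s + 1) × Fin (r + 1))

lemma tripleOpen_le_fst : tripleOpen φ ψ i τ ≤ φ ⁻¹ᵁ chart k n τ.1 := inf_le_right

lemma tripleOpen_le_snd : tripleOpen φ ψ i τ ≤ ψ ⁻¹ᵁ chart k s τ.2.1 :=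
  inf_le_left.trans inf_le_right

lemma tripleOpen_le_thd : tripleOpen φ ψ i τ ≤ i ⁻¹ᵁ chart k r τ.2.2 :=
  inf_le_left.trans inf_le_left

/-- The products of the coordinate ratios of three morphisms. -/
def tripleRatio : Fin (n + 1) × Fin (s + 1) × Fin (r + 1) → Γ(V, tripleOpen φ ψ i τ) :=
  segre (pullRatio φ (tripleOpen_le_fst φ ψ i τ)) (pullRatio ψ (tripleOpen_le_snd φ ψ i τ))
    (pullRatio i (tripleOpen_le_thd φ ψ i τ))

lemma tripleRatio_self : tripleRatio φ ψ i τ τ = 1 := by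
  simp [tripleRatio, segre, pullRatio_self]

/-- The chart of `i` is affine and generated by its ratios because `i` is a closed immersion;
separatedness of projective space lets each further chart be cut out by adjoining its own ratios. A
single ratio is a Segre product whose other two factors are `1`. -/
lemma generatedBy_tripleRatio [IsClosedImmersion i] (hφ : φ ≫ ProjSpace.toSpec k n = π)
    (hψ : ψ ≫ ProjSpace.toSpec k s = π) (hi : i ≫ ProjSpace.toSpec k r = π) :
    GeneratedBy (constHom π (tripleOpen φ ψ i τ)) (Set.range (tripleRatio φ ψ i τ)) := by
  obtain ⟨h1, g1⟩ := generatedBy_inf_preimage ψ hψ ((isAffineOpen_chart τ.2.2).preimage i)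
    (generatedBy_pullRatio i hi τ.2.2) τ.2.1
  obtain ⟨h2, g2⟩ := generatedBy_inf_preimage φ hφ h1 g1 τ.1
  refine generatedBy_of_forall fun T hc hT => g2.eq_top T hc ?_
  rintro _ (⟨_, ⟨_, ⟨l, rfl⟩, rfl⟩ | ⟨l, rfl⟩, rfl⟩ | ⟨l, rfl⟩)
  · rw [res_pullRatio, res_pullRatio]
    refine hT ⟨(τ.1, τ.2.1, l), ?_⟩
    simp only [tripleRatio, segre, pullRatio_self, one_mul]
    rfl
  · rw [res_pullRatio]
    refine hT ⟨(τ.1, l, τ.2.2), ?_⟩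
    simp only [tripleRatio, segre, pullRatio_self, one_mul, mul_one]
    rfl
  · refine hT ⟨(l, τ.2.1, τ.2.2), ?_⟩
    simp only [tripleRatio, segre, pullRatio_self, mul_one]
    rfl

lemma evalHom_pullRatio_mul_homCoords {L : Type u} [Field L] (P : Spec (.of L) ⟶ V) {U : V.Opens}
    {j : Fin (n + 1)} (hU : U ≤ φ ⁻¹ᵁ chart k n j) (hP : ⊤ ≤ P ⁻¹ᵁ U) (l : Fin (n + 1)) :
    evalHom P U hP (pullRatio φ hU l) * homCoords (P ≫ φ) j = homCoords (P ≫ φ) l := by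
  rw [evalHom_pullRatio, evalHom_ratio_mul_homCoords]

lemma top_le_preimage_tripleOpen_iff {L : Type u} [Field L] (P : Spec (.of L) ⟶ V) :
    ⊤ ≤ P ⁻¹ᵁ tripleOpen φ ψ i τ ↔
      segre (homCoords (P ≫ φ)) (homCoords (P ≫ ψ)) (homCoords (P ≫ i)) τ ≠ 0 := by
  rw [segre, mul_ne_zero_iff, mul_ne_zero_iff, homCoords_ne_zero_iff, homCoords_ne_zero_iff,
    homCoords_ne_zero_iff]
  refine ⟨fun h => ⟨h.trans fun _ hx => hx.2, h.trans fun _ hx => hx.1.2,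
    h.trans fun _ hx => hx.1.1⟩, fun ⟨h1, h2, h3⟩ => le_inf (le_inf h3 h2) h1⟩

lemma evalHom_tripleRatio_mul {L : Type u} [Field L] (P : Spec (.of L) ⟶ V)
    (hP : ⊤ ≤ P ⁻¹ᵁ tripleOpen φ ψ i τ) (σ : Fin (n + 1) × Fin (s + 1) × Fin (r + 1)) :
    evalHom P _ hP (tripleRatio φ ψ i τ σ) *
      segre (homCoords (P ≫ φ)) (homCoords (P ≫ ψ)) (homCoords (P ≫ i)) τ =
      segre (homCoords (P ≫ φ)) (homCoords (P ≫ ψ)) (homCoords (P ≫ i)) σ := by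
  rw [tripleRatio, segre, segre, segre, map_mul, map_mul,
    ← evalHom_pullRatio_mul_homCoords φ P (tripleOpen_le_fst φ ψ i τ) hP σ.1,
    ← evalHom_pullRatio_mul_homCoords ψ P (tripleOpen_le_snd φ ψ i τ) hP σ.2.1,
    ← evalHom_pullRatio_mul_homCoords i P (tripleOpen_le_thd φ ψ i τ) hP σ.2.2]
  ring

lemma tensorPow_mul_const {R ι : Type*} [CommRing R] (w : ι → R) (c : R) (M : ℕ) (t : Fin M → ι) :
    tensorPow w M t * c ^ M = tensorPow (fun j => w j * c) M t := by
  simp [tensorPow, Finset.prod_mul_distrib]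

end Comparison

end HeightRatio

end

noncomputable section

namespace HeightRatio

/-! ### Transition sections and the resulting height inequality -/

section Comparison

variable {k : Type u} [Field k] {V : Scheme.{u}} [IsIntegral V] {n s r : ℕ}
  {φ : V ⟶ ProjSpace k n} {ψ : V ⟶ ProjSpace k s} {i : V ⟶ ProjSpace k r}
  {ℓ : grading k n 1} {ℓ' : grading k s 1} {ℓ'' : grading k r 1} {A B E : Divisor V} {m : ℕ}
  {F : V.functionFieldˣ}

/-- The linear equivalence `m φ^*H ∼ m ψ^*H' + i^*H''` yields the nowhere vanishing sections
`y_l^m z_q / x_j^m` over the intersections of charts. -/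
lemma exists_transition_section (hA : IsHyperplanePullback φ ℓ A) (hB : IsHyperplanePullback ψ ℓ' B)
    (hE : IsHyperplanePullback i ℓ'' E) (hF : m • A - (m • B + E) = Divisor.principal F)
    (τ : Fin (n + 1) × Fin (s + 1) × Fin (r + 1)) :
    ∃ g : Γ(V, tripleOpen φ ψ i τ), V.basicOpen g = tripleOpen φ ψ i τ ∧
      ∀ hη : genericPoint V ∈ tripleOpen φ ψ i τ,
        toFunctionField _ hη g * (F * (ratFun ψ ℓ' (tripleOpen_le_snd φ ψ i τ hη) ^ m *
          ratFun i ℓ'' (tripleOpen_le_thd φ ψ i τ hη))) =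
            ratFun φ ℓ (tripleOpen_le_fst φ ψ i τ hη) ^ m := by
  by_cases hη : genericPoint V ∈ tripleOpen φ ψ i τ
  · obtain ⟨g, hg, hg'⟩ := exists_section_of_forall_unit (tripleOpen φ ψ i τ) hη
      (ratFun φ ℓ (tripleOpen_le_fst φ ψ i τ hη) ^ m *
        (F * (ratFun ψ ℓ' (tripleOpen_le_snd φ ψ i τ hη) ^ m *
          ratFun i ℓ'' (tripleOpen_le_thd φ ψ i τ hη)))⁻¹) fun x hx =>
      (exists_unit_of_isHyperplanePullback hA hB hE hF (tripleOpen_le_fst φ ψ i τ hx)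
        (tripleOpen_le_snd φ ψ i τ hx) (tripleOpen_le_thd φ ψ i τ hx)).2.2.2
    obtain ⟨-, h2, h3, -⟩ := exists_unit_of_isHyperplanePullback hA hB hE hF
      (tripleOpen_le_fst φ ψ i τ hη) (tripleOpen_le_snd φ ψ i τ hη) (tripleOpen_le_thd φ ψ i τ hη)
    refine ⟨g, hg', fun _ => ?_⟩
    rw [hg, inv_mul_cancel_right₀]
    exact mul_ne_zero F.ne_zero (mul_ne_zero (pow_ne_zero m h2) h3)
  -- If the generic point is missing the open set is empty, and any section will do.
  · exact ⟨1, V.basicOpen_one, fun h => absurd h hη⟩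

/-- Says that `g_τ x_j^m / (y_l^m z_q)`, with `τ = (j, l, q)`, is independent of `τ`; checked in the
function field, where `F` and the linear forms cancel. -/
lemma transition_section_mul (hA : IsHyperplanePullback φ ℓ A) (hB : IsHyperplanePullback ψ ℓ' B)
    (hE : IsHyperplanePullback i ℓ'' E) (hF : m • A - (m • B + E) = Divisor.principal F)
    {τ σ : Fin (n + 1) × Fin (s + 1) × Fin (r + 1)} {g : Γ(V, tripleOpen φ ψ i τ)}
    {g' : Γ(V, tripleOpen φ ψ i σ)}
    (hg : ∀ hη : genericPoint V ∈ tripleOpen φ ψ i τ,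
        toFunctionField _ hη g * (F * (ratFun ψ ℓ' (tripleOpen_le_snd φ ψ i τ hη) ^ m *
          ratFun i ℓ'' (tripleOpen_le_thd φ ψ i τ hη))) =
            ratFun φ ℓ (tripleOpen_le_fst φ ψ i τ hη) ^ m)
    (hg' : ∀ hη : genericPoint V ∈ tripleOpen φ ψ i σ,
        toFunctionField _ hη g' * (F * (ratFun ψ ℓ' (tripleOpen_le_snd φ ψ i σ hη) ^ m *
          ratFun i ℓ'' (tripleOpen_le_thd φ ψ i σ hη))) =
            ratFun φ ℓ (tripleOpen_le_fst φ ψ i σ hη) ^ m)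
    {W : V.Opens} (hτ : W ≤ tripleOpen φ ψ i τ) (hσ : W ≤ tripleOpen φ ψ i σ)
    (hη : genericPoint V ∈ W) :
    V.presheaf.map (homOfLE hτ).op g *
        pullRatio φ (hσ.trans (tripleOpen_le_fst φ ψ i σ)) τ.1 ^ m =
      V.presheaf.map (homOfLE hσ).op g' *
        (pullRatio ψ (hσ.trans (tripleOpen_le_snd φ ψ i σ)) τ.2.1 ^ m *
          pullRatio i (hσ.trans (tripleOpen_le_thd φ ψ i σ)) τ.2.2) := by
  refine toFunctionField_injective W hη ?_
  obtain ⟨-, h2, h3, -⟩ := exists_unit_of_isHyperplanePullback hA hB hE hF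
    (tripleOpen_le_fst φ ψ i τ (hτ hη)) (tripleOpen_le_snd φ ψ i τ (hτ hη))
    (tripleOpen_le_thd φ ψ i τ (hτ hη))
  have e1 := ratFun_mul φ ℓ (hτ.trans (tripleOpen_le_fst φ ψ i τ))
    (hσ.trans (tripleOpen_le_fst φ ψ i σ)) hη
  have e2 := ratFun_mul ψ ℓ' (hτ.trans (tripleOpen_le_snd φ ψ i τ))
    (hσ.trans (tripleOpen_le_snd φ ψ i σ)) hη
  have e3 := ratFun_mul i ℓ'' (hτ.trans (tripleOpen_le_thd φ ψ i τ))
    (hσ.trans (tripleOpen_le_thd φ ψ i σ)) hη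
  have d1 := hg (hτ hη)
  have d2 := hg' (hσ hη)
  simp only [map_mul, map_pow, toFunctionField_res]
  refine mul_right_cancel₀ (mul_ne_zero F.ne_zero (mul_ne_zero (pow_ne_zero m h2) h3)) ?_
  calc _ = toFunctionField _ (hτ hη) g * (F * (ratFun ψ ℓ' (tripleOpen_le_snd φ ψ i τ (hτ hη)) ^ m *
          ratFun i ℓ'' (tripleOpen_le_thd φ ψ i τ (hτ hη)))) *
          toFunctionField W hη (pullRatio φ (hσ.trans (tripleOpen_le_fst φ ψ i σ)) τ.1) ^ m := by
        ring
    _ = ratFun φ ℓ (tripleOpen_le_fst φ ψ i σ (hσ hη)) ^ m := by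
        rw [d1, ← mul_pow, e1]
    _ = _ := by
        rw [← d2, ← e2, ← e3]
        ring

variable {π : V ⟶ Spec (.of k)} [CharZero k] [Algebra.IsAlgebraic ℚ k]

/-- If `m φ^*H ∼ m ψ^*H' + i^*H''` with `i` a closed embedding, then
`m h(ψ(P)) + h(i(P)) ≤ m h(φ(P)) + O(1)`. -/
theorem exists_mul_mapHeight_add_le [IsClosedImmersion i] (hφ : φ ≫ ProjSpace.toSpec k n = π)
    (hψ : ψ ≫ ProjSpace.toSpec k s = π) (hi : i ≫ ProjSpace.toSpec k r = π)
    (hA : IsHyperplanePullback φ ℓ A) (hB : IsHyperplanePullback ψ ℓ' B)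
    (hE : IsHyperplanePullback i ℓ'' E) (hF : m • A - (m • B + E) = Divisor.principal F) :
    ∃ C : ℝ, ∀ P : GeomPoint π,
      m * mapHeight ψ P + mapHeight i P ≤ m * mapHeight φ P + C := by
  choose g hg0 hg using exists_transition_section hA hB hE hF
  choose N hN using fun τ => (generatedBy_tripleRatio φ ψ i τ hφ hψ hi).exists_forms
    (tripleRatio_self φ ψ i τ) (g τ)
  obtain ⟨M, hM⟩ : ∃ M, ∀ τ, N τ ≤ M :=
    ⟨Finset.univ.sup N, fun τ => Finset.le_sup (Finset.mem_univ τ)⟩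
  choose a ha using fun τ => hN τ M (hM τ)
  obtain ⟨C, hC⟩ := mul_absLogHeight_add_le_of_forms (F := AlgebraicClosure k) m M
    (fun p : (Fin (n + 1) × Fin (s + 1) × Fin (r + 1)) × _ =>
      algebraMap k (AlgebraicClosure k) (a p.1 p.2))
  refine ⟨C, fun P => ?_⟩
  set x := homCoords (P.1 ≫ φ) with hx
  set y := homCoords (P.1 ≫ ψ) with hy
  set z := homCoords (P.1 ≫ i) with hz
  obtain ⟨σ, hσ⟩ := Function.ne_iff.1 (segre_ne_zero (homCoords_ne_zero (P.1 ≫ φ))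
    (homCoords_ne_zero (P.1 ≫ ψ)) (homCoords_ne_zero (P.1 ≫ i)))
  have hPσ := (top_le_preimage_tripleOpen_iff φ ψ i σ P.1).2 hσ
  have hσ' : segre x y z σ ≠ 0 := hσ
  rw [segre, mul_ne_zero_iff, mul_ne_zero_iff] at hσ'
  obtain ⟨hx0, hy0, hz0⟩ := hσ'
  have hgσ : evalHom P.1 _ hPσ (g σ) ≠ 0 := by
    rw [evalHom_ne_zero_iff, hg0]; exact hPσ
  -- The scalar `a` is the value at `P` of the quantity independent of the chart, computed on the
  -- chart `σ`. It may vary with `P`, as scaling leaves heights unchanged.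
  refine hC x y z (evalHom P.1 _ hPσ (g σ) * x σ.1 ^ m / (y σ.2.1 ^ m * z σ.2.2))
    (homCoords_ne_zero _) (homCoords_ne_zero _) (homCoords_ne_zero _)
    (div_ne_zero (mul_ne_zero hgσ (pow_ne_zero m hx0)) (mul_ne_zero (pow_ne_zero m hy0) hz0))
    fun τ hτ => ?_
  have hPτ := (top_le_preimage_tripleOpen_iff φ ψ i τ P.1).2 hτ
  have hPW : ⊤ ≤ P.1 ⁻¹ᵁ (tripleOpen φ ψ i τ ⊓ tripleOpen φ ψ i σ) := le_inf hPτ hPσ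
  have hη := genericPoint_mem_of_mem ((top_le_preimage_iff _ _).1 hPW)
  have h1 := congrArg (evalHom P.1 _ hPW)
    (transition_section_mul hA hB hE hF (hg τ) (hg σ) inf_le_left inf_le_right hη)
  rw [map_mul, map_mul, map_mul, map_pow, map_pow, evalHom_res P.1 inf_le_left hPW hPτ,
    evalHom_res P.1 inf_le_right hPW hPσ] at h1
  -- Multiplying by `t_τ^M` turns the form in the ratios `t / t_τ` into the same form in the Segre
  -- coordinates `t`.
  have h2 : evalHom P.1 _ hPτ (g τ) * segre x y z τ ^ M =
      ∑ t, algebraMap k (AlgebraicClosure k) (a τ t) * tensorPow (segre x y z) M t := by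
    conv_lhs => rw [ha τ, map_sum, Finset.sum_mul]
    refine Finset.sum_congr rfl fun t _ => ?_
    rw [map_mul, evalHom_constHom π P.1 P.2, eval_tensorPow, mul_assoc, tensorPow_mul_const]
    simp only [hx, hy, hz, evalHom_tripleRatio_mul]
  have e1 := evalHom_pullRatio_mul_homCoords φ P.1
    ((inf_le_right : tripleOpen φ ψ i τ ⊓ _ ≤ _).trans (tripleOpen_le_fst φ ψ i σ)) hPW τ.1
  have e2 := evalHom_pullRatio_mul_homCoords ψ P.1
    ((inf_le_right : tripleOpen φ ψ i τ ⊓ _ ≤ _).trans (tripleOpen_le_snd φ ψ i σ)) hPW τ.2.1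
  have e3 := evalHom_pullRatio_mul_homCoords i P.1
    ((inf_le_right : tripleOpen φ ψ i τ ⊓ _ ≤ _).trans (tripleOpen_le_thd φ ψ i σ)) hPW τ.2.2
  have h3 : evalHom P.1 _ hPσ (g σ) * x σ.1 ^ m / (y σ.2.1 ^ m * z σ.2.2) *
      (y τ.2.1 ^ m * z τ.2.2) = x τ.1 ^ m * evalHom P.1 _ hPτ (g τ) := by
    rw [div_mul_eq_mul_div, div_eq_iff (mul_ne_zero (pow_ne_zero m hy0) hz0)]
    simp only [hx, hy, hz, ← e1, ← e2, ← e3, mul_pow]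
    linear_combination (-(x σ.1 ^ m * y σ.2.1 ^ m * z σ.2.2)) * h1
  rw [← h2, h3, mul_assoc]

end Comparison

end HeightRatio

end

noncomputable section

namespace HeightRatio

/-! ### Weil heights and ample divisors -/

lemma nsmul_sub_nsmul_add_eq {G : Type*} [AddCommGroup G] (m : ℕ) (A B E D A' B' : G) :
    m • A - (m • B + E) =
      m • (B' - B) - m • (A' - A) - m • (D - (A' - B')) + (m • D - E) := by
  module

section Weil

variable {k : Type u} [Field k] [CharZero k] [Algebra.IsAlgebraic ℚ k] {V : Scheme.{u}}
  {π : V ⟶ Spec (.of k)}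

lemma mapHeight_nonneg {n : ℕ} (φ : V ⟶ ProjSpace k n) (P : GeomPoint π) : 0 ≤ mapHeight φ P :=
  absLogHeight_nonneg _

variable [IsIntegral V]

/-- An ample height bounds from above the height attached to some closed embedding. -/
lemma exists_mapHeight_le_of_isAmple {D : Divisor V} {h : GeomPoint π → ℝ} (hD : IsAmple π D)
    (hh : IsWeilHeight π D h) :
    ∃ (r : ℕ) (i : V ⟶ ProjSpace k r) (m : ℕ) (C : ℝ), i ≫ ProjSpace.toSpec k r = π ∧
      IsClosedImmersion i ∧ ∀ P, mapHeight i P ≤ m * h P + C := by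
  obtain ⟨m, -, r, i, hi, hcl, ℓ'', E, hE, hDE⟩ := hD
  obtain ⟨n, s, φ, ψ, A₀, B₀, hφ, hψ, ⟨ℓ, A, hA, hAA⟩, ⟨ℓ', B, hB, hBB⟩, hDAB, C', hC'⟩ := hh
  -- Combines `mD ∼ E` with `D ∼ A₀ - B₀`, `A₀ ∼ A` and `B₀ ∼ B`, where `A`, `B`, `E` are actual
  -- hyperplane pullbacks.
  obtain ⟨F, hF⟩ : ((m • A).LinEquiv (m • B + E)) := by
    rw [linEquiv_iff] at *
    have : m • A - (m • B + E) =
        m • (B₀ - B) - m • (A₀ - A) - m • (D - (A₀ - B₀)) + (m • D - E) :=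
      nsmul_sub_nsmul_add_eq m A B E D A₀ B₀
    rw [this]
    exact add_mem (sub_mem (sub_mem (nsmul_mem hBB m) (nsmul_mem hAA m)) (nsmul_mem hDAB m)) hDE
  obtain ⟨C, hC⟩ := exists_mul_mapHeight_add_le hφ hψ hi hA hB hE hF
  refine ⟨r, i, m, C + m * C', hi, hcl, fun P => ?_⟩
  have h1 := hC P
  have h2 := mul_le_mul_of_nonneg_left (abs_le.1 (hC' P)).1 (Nat.cast_nonneg (α := ℝ) m)
  linarith

/-- Every Weil height is bounded in terms of the height attached to a closed embedding. -/
lemma exists_abs_le_mapHeight {E : Divisor V} {h : GeomPoint π → ℝ} (hh : IsWeilHeight π E h)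
    {r : ℕ} (i : V ⟶ ProjSpace k r) [IsClosedImmersion i] (hi : i ≫ ProjSpace.toSpec k r = π) :
    ∃ (N : ℕ) (C : ℝ), ∀ P, |h P| ≤ N * mapHeight i P + C := by
  obtain ⟨n, s, φ, ψ, -, -, -, -, -, -, -, C', hC'⟩ := hh
  obtain ⟨N₁, C₁, h₁⟩ := exists_mapHeight_le (π := π) i hi φ
  obtain ⟨N₂, C₂, h₂⟩ := exists_mapHeight_le (π := π) i hi ψ
  refine ⟨N₁ + N₂, C' + C₁ + C₂, fun P => ?_⟩
  have e := abs_le.1 (hC' P)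
  have := h₁ P
  have := h₂ P
  have := mapHeight_nonneg φ P
  have := mapHeight_nonneg ψ P
  push_cast
  rw [abs_le]
  constructor <;> linarith [e.1, e.2]

/-- Every Weil height is dominated by an ample height. -/
theorem exists_abs_le_of_isAmple {D E : Divisor V} {hD hE : GeomPoint π → ℝ} (hA : IsAmple π D)
    (hhD : IsWeilHeight π D hD) (hhE : IsWeilHeight π E hE) :
    ∃ a b : ℝ, 0 ≤ a ∧ 0 ≤ b ∧ ∀ P, |hE P| ≤ a * hD P + b := by
  obtain ⟨r, i, m, C, hi, hcl, h₁⟩ := exists_mapHeight_le_of_isAmple hA hhD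
  obtain ⟨N, C', h₂⟩ := exists_abs_le_mapHeight hhE i hi
  refine ⟨N * m, |N * C + C'|, by positivity, abs_nonneg _, fun P => ?_⟩
  have := mul_le_mul_of_nonneg_left (h₁ P) (Nat.cast_nonneg (α := ℝ) N)
  linarith [h₂ P, le_abs_self (N * C + C')]

end Weil

/-! ### Limits of ratios of dominated functions -/

section Limits

variable {α : Type*} {f g : α → ℝ} {a b : ℝ}

lemma eventually_le_comap_atTop (g : α → ℝ) (c : ℝ) : ∀ᶠ x in comap g atTop, c ≤ g x :=
  (eventually_ge_atTop c).comap g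

lemma limsup_abs_div_lt_top (hb : 0 ≤ b) (h : ∀ x, |f x| ≤ a * g x + b) :
    limsup (fun x => ((|f x / g x| : ℝ) : EReal)) (comap g atTop) < ⊤ := by
  -- Once `g ≥ 1`, the constant satisfies `b ≤ b g`, so the ratio is at most `a + b`.
  refine (limsup_le_of_le (a := ((a + b : ℝ) : EReal)) (by isBoundedDefault) ?_).trans_lt
    (EReal.coe_lt_top _)
  filter_upwards [eventually_le_comap_atTop g 1] with x hx
  rw [EReal.coe_le_coe_iff, abs_div, abs_of_pos (zero_lt_one.trans_le hx),
    div_le_iff₀ (zero_lt_one.trans_le hx)]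
  nlinarith [h x]

lemma liminf_div_pos (ha : 0 ≤ a) (h : ∀ x, g x ≤ a * f x + b) :
    0 < liminf (fun x => ((f x / g x : ℝ) : EReal)) (comap g atTop) := by
  -- For `g ≥ 2b` the hypothesis gives `g / 2 ≤ a f`; using `a + 1` avoids dividing by zero when `a
  -- = 0`, and costs nothing once `f ≥ 0` is known.
  have hc : (0 : ℝ) < (2 * (a + 1))⁻¹ := by positivity
  refine (EReal.coe_pos.2 hc).trans_le (le_liminf_of_le (by isBoundedDefault) ?_)
  filter_upwards [eventually_le_comap_atTop g 1, eventually_le_comap_atTop g (2 * b)] with x h1 h2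
  have hx := h x
  have hf : 0 ≤ f x := by
    by_contra! hf
    nlinarith [mul_nonpos_of_nonneg_of_nonpos ha hf.le]
  rw [EReal.coe_le_coe_iff, le_div_iff₀ (zero_lt_one.trans_le h1), inv_mul_le_iff₀ (by positivity)]
  linarith

end Limits

end HeightRatio

end
theorem mainTheorem6 {k : Type u} [Field k] [CharZero k] [Algebra.IsAlgebraic ℚ k]
    (V : Scheme.{u}) [IsIntegral V] (π : V ⟶ Spec (.of k)) (hV : IsProjective π) :
    (∀ (D₁ D₂ : Divisor V) (h₁ h₂ : GeomPoint π → ℝ),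
      IsAmple π D₁ → IsAmple π D₂ → IsWeilHeight π D₁ h₁ → IsWeilHeight π D₂ h₂ →
        0 < liminf (fun P => ((h₁ P / h₂ P : ℝ) : EReal)) (comap h₂ atTop) ∧
        limsup (fun P => ((h₁ P / h₂ P : ℝ) : EReal)) (comap h₂ atTop) < ⊤ ∧
        limsup (fun P => ((|h₁ P / h₂ P| : ℝ) : EReal)) (comap h₂ atTop) < ⊤) ∧
    (∀ (D E : Divisor V) (hD hE : GeomPoint π → ℝ),
      IsAmple π D → IsWeilHeight π D hD → IsWeilHeight π E hE →
        limsup (fun P => ((|hE P / hD P| : ℝ) : EReal)) (comap hD atTop) < ⊤) := by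
  have key : ∀ (D E : Divisor V) (hD hE : GeomPoint π → ℝ),
      IsAmple π D → IsWeilHeight π D hD → IsWeilHeight π E hE →
        limsup (fun P => ((|hE P / hD P| : ℝ) : EReal)) (comap hD atTop) < ⊤ := by
    intro D E hD hE hA hhD hhE
    obtain ⟨a, b, -, hb, h⟩ := exists_abs_le_of_isAmple hA hhD hhE
    exact limsup_abs_div_lt_top hb h
  refine ⟨fun D₁ D₂ h₁ h₂ hA₁ hA₂ hh₁ hh₂ => ?_, key⟩
  have habs := key D₂ D₁ h₂ h₁ hA₂ hh₂ hh₁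
  refine ⟨?_, lt_of_le_of_lt (limsup_le_limsup ?_) habs, habs⟩
  -- Here the ampleness of `D₁` is used, to dominate `h₂` by `h₁`.
  · obtain ⟨a, b, ha, -, h⟩ := exists_abs_le_of_isAmple hA₁ hh₁ hh₂
    exact liminf_div_pos ha fun P => (le_abs_self _).trans (h P)
  · exact Eventually.of_forall fun P => EReal.coe_le_coe_iff.2 (le_abs_self _)
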